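/- **Setting.** Let $\pi$ be a probability distribution on a measurable space $(\mathsf X,\mathcal X)$, $q$ a Markov kernel on $\mathsf X$, $(\mathsf U,\mathcal U)$ a measurable space, $\{Q_{x,y}\}_{x,y\in\mathsf X}$ a (measurable) family of probability distributions on $\mathsf U$, $\varphi:\mathsf U\to\mathsf U$ a measurable involution, and $\bar Q_{x,y}(A):=Q_{x,y}(\varphi(A))$. For finite measures $\mu,\mu'$ on a common space, write $\eta,\eta'$ for their densities with respect to $\mu+\mu'$; the acceptance ratio $\mu'/\mu$ denotes $\eta'/\eta$ on $\{\eta>0,\ \eta'>0\}$ and $0$ elsewhere. Put $$r(x,y)=\frac{\pi(\mathrm dy)q(y,\mathrm dx)}{\pi(\mathrm dx)q(x,\mathrm dy)},\qquad \mathring r_u(x,y)=\frac{\pi(\mathrm dy)q(y,\mathrm dx)\bar Q_{y,x}(\mathrm du)}{\pi(\mathrm dx)q(x,\mathrm dy)Q_{x,y}(\mathrm du)},\qquad \mathring r^N_{\mathfrak u}(x,y)=\frac1N\sum_{i=1}^N\mathring r_{u^{(i)}}(x,y),\quad \mathfrak u=(u^{(1)},\dots,u^{(N)}),$$ and let $P(x,\mathrm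 dy)=q(x,\mathrm dy)\min\{1,r(x,y)\}+\rho(x)\delta_x(\mathrm dy)$ be the Metropolis–Hastings kernel, $\rho(x)$ being the rejection probability. For $N\ge1$ let $Q^N_{x,y}$ $(x,y\in\mathsf X)$ be a (measurable) family of probability distributions on $\mathsf U^N$ all of whose one-dimensional marginals equal $Q_{x,y}$, having for each $k$ a (jointly measurable) regular conditional law $Q^N_{x,y}(\mathrm d\mathfrak u^{(-k)}\mid u^{(k)})$ of the other components $\mathfrak u^{(-k)}$ given $u^{(k)}$; any version may be used. Let $$Q_1^N(x,\mathrm d(y,\mathfrak u,k))=q(x,\mathrm dy)\,Q^N_{x,y}(\mathrm d\mathfrak u)\,\frac{\mathring r_{u^{(k)}}(x,y)}{\sum_{i=1}^N\mathring r_{u^{(i)}}(x,y)},\qquad Q_2^N(x,\mathrm d(y,\mathfrak u,k))=q(x,\mathrm dy)\,\frac1N\,\bar Q_{x,y}(\mathrm du^{(k)})\,Q^N_{y,x}(\mathrm d\mathfrak u^{(-k)}\mid u^{(k)}),$$ ($k\in\{1,\dots,N\}$; $k$ is uniform in $Q_1^N$ if all the $\mathring r_{u^{(i)}}(x,y)$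 vanish), and $$\mathring P^N(x,\mathrm dy)=\tfrac12\Big[\int Q_1^N(x,\mathrm d(y,\mathfrak u,k))\min\{1,\mathring r^N_{\mathfrak u}(x,y)\}+\mathring\rho_1(x)\delta_x(\mathrm dy)\Big]+\tfrac12\Big[\int Q_2^N(x,\mathrm d(y,\mathfrak u,k))\min\{1,1/\mathring r^N_{\mathfrak u}(y,x)\}+\mathring\rho_2(x)\delta_x(\mathrm dy)\Big],$$ where $\mathring\rho_1,\mathring\rho_2$ are the rejection probabilities, the integrals are over $(\mathfrak u,k)$, and the acceptance ratio $1/\mathring r^N_{\mathfrak u}(y,x)$ of the second move is understood to be $0$ where $\mathring r_{u^{(k)}}(y,x)=0$ (the points at which the forward and backward densities are not both positive). For a $\pi$-reversible Markov kernel $\Pi$ and $f\in L^2(\pi)$ put $\mathcal E_\Pi(f)=\frac12\int\pi(\mathrm dx)\Pi(x,\mathrm dy)(f(x)-f(y))^2$, $\mathrm{Gap}_R(\Pi)=\inf\{\mathcal E_\Pi(f):f\in L^2(\pi),\ \pi(f)=0,\ \mathrm{var}_\pi(f)=1\}$ (with $\inf\emptyset=+\infty$) and $\mathrm{var}(f,\Pi)=\lim_{M\to\infty}\mathrm{var}\big(M^{-1/2}\sum_{i=1}^Mf(X_i)\big)\in[0,\infty]$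 for the stationary chain with $X_0\sim\pi$ and kernel $\Pi$. **Theorem.** 1. For every $N\ge1$ and every such $Q^N$, $\mathring P^N$ is $\pi$-reversible. 2. Suppose that $u^{(1)},\dots,u^{(N)}$ are exchangeable under $Q^N_{x,y}$ for all $x,y$. Then $\mathrm{Gap}_R(\mathring P^N)\le\mathrm{Gap}_R(P)$, and for every $f\in L^2(\pi)$ the limits defining $\mathrm{var}(f,\mathring P^N)$ and $\mathrm{var}(f,P)$ exist in $[0,\infty]$ and $\mathrm{var}(f,\mathring P^N)\ge\mathrm{var}(f,P)$. 3. Let $1\le N\le M$, let $Q^N_{x,y}$ and $Q^M_{x,y}$ be exchangeable for all $x,y$, and suppose that $Q^N_{x,y}$ is the law of $(u^{(1)},\dots,u^{(N)})$ under $Q^M_{x,y}$. Then $\mathrm{Gap}_R(\mathring P^N)\le\mathrm{Gap}_R(\mathring P^M)$, and for every $f\in L^2(\pi)$: $\mathcal E_{\mathring P^N}(f)\le\mathcal E_{\mathring P^M}(f)$; the first order auto-covariance $\mathrm{cov}(f(X_0),f(X_1))$ of the stationary chain is at least as large for $\mathring P^N$ as for $\mathring P^M$; and $\mathrm{var}(f,\mathring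 P^N)\ge\mathrm{var}(f,\mathring P^M)$. -/

import Mathlib

open MeasureTheory ProbabilityTheory Filter Topology
open scoped ENNReal

noncomputable section

namespace MHAAR

/-! ### Performance measures of a Markov kernel `P` with invariant distribution `μ` -/

section Performance

variable {E : Type*} [MeasurableSpace E]

/-- The law of `(X₀, …, X_n)` for the Markov chain with initial law `μ` and transition kernel `P`. -/
def pathLaw (μ : Measure E) (P : Kernel E E) : (n : ℕ) → Measure (Fin (n + 1) → E)
  | 0 => μ.map (fun x _ => x)
  | n + 1 =>
    ((pathLaw μ P n) ⊗ₘ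
        (P.comap (fun ω : Fin (n + 1) → E => ω (Fin.last n)) (measurable_pi_apply _))).map
      (fun p => Fin.snoc (α := fun _ => E) p.1 p.2)

/-- `var(M^{-1/2} ∑_{i=1}^M f(X_i))` for the chain started from `X₀ ∼ μ`. -/
def scaledVariance (μ : Measure E) (P : Kernel E E) (f : E → ℝ) (M : ℕ) : ℝ≥0∞ :=
  evariance (fun ω : Fin (M + 1) → E => (√(M : ℝ))⁻¹ * ∑ i : Fin M, f (ω i.succ)) (pathLaw μ P M)

/-- The asymptotic variance, in `[0, ∞]`: the limit of `scaledVariance μ P f M` as `M → ∞`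
whenever that limit exists (the upper limit in general). -/
def asymptoticVariance (μ : Measure E) (P : Kernel E E) (f : E → ℝ) : ℝ≥0∞ :=
  limsup (scaledVariance μ P f) atTop

/-- The limit defining the asymptotic variance exists in `[0, ∞]`. -/
def AsymptoticVarianceExists (μ : Measure E) (P : Kernel E E) (f : E → ℝ) : Prop :=
  Tendsto (scaledVariance μ P f) atTop (𝓝 (asymptoticVariance μ P f))

/-- The Dirichlet form `½ ∫ μ(dx) P(x, dy) (f x - f y)²`. -/
def dirichletForm (μ : Measure E) (P : Kernel E E) (f : E → ℝ) : ℝ≥0∞ :=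
  2⁻¹ * ∫⁻ x, ∫⁻ y, ENNReal.ofReal ((f x - f y) ^ 2) ∂(P x) ∂μ

/-- The right spectral gap: the infimum of the Dirichlet form over centred square integrable
functions of unit variance (`∞` if there are none). -/
def rightGap (μ : Measure E) (P : Kernel E E) : ℝ≥0∞ :=
  ⨅ f ∈ {f : E → ℝ | MemLp f 2 μ ∧ ∫ x, f x ∂μ = 0 ∧ variance f μ = 1}, dirichletForm μ P f

/-- The first order auto-covariance `cov(f(X₀), f(X₁))` with `X₀ ∼ μ`, `X₁ ∼ P(X₀, ·)`. -/
def autocovariance (μ : Measure E) (P : Kernel E E) (f : E → ℝ) : ℝ :=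
  covariance (fun p : E × E => f p.1) (fun p => f p.2) (μ ⊗ₘ P)

end Performance

/-! ### Acceptance ratios and acceptance-rejection kernels -/

/-- The acceptance ratio `dμ'/dμ`: with `ν = μ + μ'`, `η = dμ/dν` and `η' = dμ'/dν`, it equals
`η'/η` on the set `{η > 0, η' > 0}` and `0` elsewhere. In particular it is positive exactly on that
set. -/
def acceptanceRatio {Z : Type*} [MeasurableSpace Z] (μ μ' : Measure Z) (z : Z) : ℝ :=
  let η : ℝ := (μ.rnDeriv (μ + μ') z).toReal
  let η' : ℝ := (μ'.rnDeriv (μ + μ') z).toReal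
  if 0 < η ∧ 0 < η' then η' / η else 0

section Kernels

variable {X U : Type*} [MeasurableSpace X] [MeasurableSpace U]

/-- The kernel `x ↦ ∫_W Q(x, d(y, w)) a(x, y, w) + ρ(x) δ_x(dy)`: a proposal `(y, w) ∼ Q(x, ·)` is
accepted with probability `a x y w`, and `ρ x` is the probability of a rejection. -/
def acceptReject {W : Type*} [MeasurableSpace W] (Q : Kernel X (X × W)) [IsSFiniteKernel Q]
    (a : X → X × W → ℝ) : Kernel X X :=
  (Q.withDensity (fun x p => ENNReal.ofReal (a x p))).map Prod.fst +
    (Kernel.id : Kernel X X).withDensity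
      (fun x _ => 1 - ∫⁻ p, ENNReal.ofReal (a x p) ∂(Q x))

/-- The equal mixture `½ P₁ + ½ P₂` of two kernels. -/
def halfMix (P₁ P₂ : Kernel X X) : Kernel X X where
  toFun x := (2⁻¹ : ℝ≥0∞) • P₁ x + (2⁻¹ : ℝ≥0∞) • P₂ x
  measurable' := by
    refine Measure.measurable_of_measurable_coe _ fun s hs => ?_
    simp only [Measure.add_apply, Measure.smul_apply, smul_eq_mul]
    exact ((P₁.measurable_coe hs).const_mul _).add ((P₂.measurable_coe hs).const_mul _)

/-- `r(x, y) = π(dy) q(y, dx) / π(dx) q(x, dy)`. -/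
def mhRatio (π : Measure X) (q : Kernel X X) (x y : X) : ℝ :=
  acceptanceRatio (π ⊗ₘ q) ((π ⊗ₘ q).map Prod.swap) (x, y)

/-- The Metropolis-Hastings kernel `P` with target `π` and proposal `q`. -/
def mhKernel (π : Measure X) (q : Kernel X X) [IsMarkovKernel q] : Kernel X X :=
  acceptReject (q.map (fun y => (y, ()))) (fun x p => min 1 (mhRatio π q x p.1))

/-- `r̊_u(x, y) = π(dy) Q₂(y, d(x, u)) / π(dx) Q₁(x, d(y, u))`, where
`Q₁(x, d(y, u)) = q(x, dy) Q_{x,y}(du)` and `Q₂(x, d(y, u)) = q(x, dy) Q̄_{x,y}(du)`, with `Q̄_{x,y}`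
the image of `Q_{x,y}` under the involution `φ`. -/
def pmrRatio (π : Measure X) (q : Kernel X X) (Q : Kernel (X × X) U) (φ : U → U)
    (u : U) (x y : X) : ℝ :=
  acceptanceRatio (π ⊗ₘ (q ⊗ₖ Q))
    ((π ⊗ₘ (q ⊗ₖ (Q.map φ))).map (fun p : X × X × U => (p.2.1, p.1, p.2.2))) (x, y, u)

/-- The averaged ratio `r̊^N_𝔲(x, y) = N⁻¹ ∑ᵢ r̊_{u⁽ⁱ⁾}(x, y)`. -/
def avgRatio (π : Measure X) (q : Kernel X X) (Q : Kernel (X × X) U) (φ : U → U) {N : ℕ}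
    (𝔲 : Fin N → U) (x y : X) : ℝ :=
  (∑ i, pmrRatio π q Q φ (𝔲 i) x y) / N

/-- Joint laws `Q^N_{x,y}` of `(u⁽¹⁾, …, u⁽ᴺ⁾)`, all of whose marginals are equal to `Q_{x,y}`,
together with a version `Q^N_{x,y}(d𝔲⁽⁻ᵏ⁾ ∣ u⁽ᵏ⁾)` of the conditional law of the other components
given the `k`-th one, for every `k`. -/
structure JointLaw (Q : Kernel (X × X) U) (N : ℕ) where
  /-- The law `Q^N_{x,y}`, for `(x, y) ∈ X × X`. -/
  joint : Kernel (X × X) (Fin N → U)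
  markov_joint : IsMarkovKernel joint
  map_eval : ∀ (p : X × X) (k : Fin N), (joint p).map (fun 𝔲 => 𝔲 k) = Q p
  /-- `cond k ((x, y), u)` is the law `Q^N_{x,y}(d𝔲⁽⁻ᵏ⁾ ∣ u⁽ᵏ⁾ = u)`. -/
  cond (k : Fin N) : Kernel ((X × X) × U) ({i : Fin N // i ≠ k} → U)
  markov_cond : ∀ k, IsMarkovKernel (cond k)
  disintegrate : ∀ (p : X × X) (k : Fin N),
    (joint p).map (fun 𝔲 => (𝔲 k, fun i : {i : Fin N // i ≠ k} => 𝔲 i)) =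
      Q p ⊗ₘ (cond k).comap (fun u => (p, u)) measurable_prodMk_left

attribute [instance] JointLaw.markov_joint JointLaw.markov_cond

/-- `u⁽¹⁾, …, u⁽ᴺ⁾` are exchangeable with respect to `Q^N_{x,y}`, for all `x, y`. -/
def JointLaw.Exchangeable {Q : Kernel (X × X) U} {N : ℕ} (J : JointLaw Q N) : Prop :=
  ∀ (p : X × X) (σ : Equiv.Perm (Fin N)), (J.joint p).map (fun 𝔲 i => 𝔲 (σ i)) = J.joint p

/-- `Q^N_{x,y}` is the law of the first `N` components under `Q^M_{x,y}`, for all `x, y`. -/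
def JointLaw.IsInitialPartOf {Q : Kernel (X × X) U} {N M : ℕ} (J : JointLaw Q N)
    (K : JointLaw Q M) (h : N ≤ M) : Prop :=
  ∀ p : X × X, (K.joint p).map (fun 𝔲 i => 𝔲 (Fin.castLE h i)) = J.joint p

/-- The vector with `k`-th component `u` and other components `v`. -/
def glue {N : ℕ} (k : Fin N) (u : U) (v : {i : Fin N // i ≠ k} → U) : Fin N → U :=
  fun i => if h : i = k then u else v ⟨i, h⟩

variable (π : Measure X) (q : Kernel X X) [IsMarkovKernel q] (Q : Kernel (X × X) U)
  [IsMarkovKernel Q] (φ : U → U)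

/-- The probability `r̊_{u⁽ᵏ⁾}(x, y) / ∑ᵢ r̊_{u⁽ⁱ⁾}(x, y)` of choosing `k` (uniform if all the ratios
vanish, in which case the choice is irrelevant as the acceptance probability is zero). -/
def indexWeight {N : ℕ} (x y : X) (𝔲 : Fin N → U) (k : Fin N) : ℝ :=
  if ∑ i, pmrRatio π q Q φ (𝔲 i) x y = 0 then (N : ℝ)⁻¹
  else pmrRatio π q Q φ (𝔲 k) x y / ∑ i, pmrRatio π q Q φ (𝔲 i) x y

/-- `Q₁^N(x, d(y, 𝔲, k)) = q(x, dy) Q^N_{x,y}(d𝔲) r̊_{u⁽ᵏ⁾}(x, y) / ∑ᵢ r̊_{u⁽ⁱ⁾}(x, y)`. -/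
def proposal₁ {N : ℕ} (J : JointLaw Q N) : Kernel X (X × (Fin N → U) × Fin N) :=
  q ⊗ₖ (J.joint ⊗ₖ
    (Kernel.const ((X × X) × (Fin N → U)) (Measure.count : Measure (Fin N))).withDensity
      (fun p k => ENNReal.ofReal (indexWeight π q Q φ p.1.1 p.1.2 p.2 k)))

instance {N : ℕ} (J : JointLaw Q N) : IsSFiniteKernel (proposal₁ π q Q φ J) := by
  have := Kernel.IsSFiniteKernel.withDensity
    (Kernel.const ((X × X) × (Fin N → U)) (Measure.count : Measure (Fin N)))
    (f := fun p k => ENNReal.ofReal (indexWeight π q Q φ p.1.1 p.1.2 p.2 k))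
    (fun _ _ => ENNReal.ofReal_ne_top)
  unfold proposal₁
  infer_instance

/-- `Q₂^N(x, d(y, 𝔲, k)) = q(x, dy) N⁻¹ Q̄_{x,y}(du⁽ᵏ⁾) Q^N_{y,x}(d𝔲⁽⁻ᵏ⁾ ∣ u⁽ᵏ⁾)`. -/
def proposal₂ {N : ℕ} (J : JointLaw Q N) : Kernel X (X × (Fin N → U) × Fin N) :=
  q ⊗ₖ ∑ k : Fin N,
    (((Q.map φ) ⊗ₖ (J.cond k).comap (fun p : (X × X) × U => (p.1.swap, p.2))
        ((measurable_swap.comp measurable_fst).prodMk measurable_snd)).map (fun p => (glue k p.1 p.2, k))).withDensity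
      (fun _ _ => (N : ℝ≥0∞)⁻¹)

instance {N : ℕ} (J : JointLaw Q N) : IsSFiniteKernel (proposal₂ q Q φ J) := by
  unfold proposal₂
  infer_instance

/-- The acceptance probability `min{1, r̊^N_𝔲(x, y)}` of a proposal from `Q₁^N`. -/
def acceptProb₁ {N : ℕ} (x : X) (p : X × (Fin N → U) × Fin N) : ℝ :=
  min 1 (avgRatio π q Q φ p.2.1 x p.1)

/-- The acceptance probability `min{1, 1 / r̊^N_𝔲(y, x)}` of a proposal from `Q₂^N`, where the
reverse acceptance ratio is zero, as always, off the set on which the forward and backward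
densities are both positive, that is, where `r̊_{u⁽ᵏ⁾}(y, x)` vanishes. -/
def acceptProb₂ {N : ℕ} (x : X) (p : X × (Fin N → U) × Fin N) : ℝ :=
  if 0 < pmrRatio π q Q φ (p.2.1 p.2.2) p.1 x then min 1 (1 / avgRatio π q Q φ p.2.1 p.1 x) else 0

/-- The averaged-ratio kernel `P̊^N`. -/
def avgKernel {N : ℕ} (J : JointLaw Q N) : Kernel X X :=
  halfMix (acceptReject (proposal₁ π q Q φ J) (acceptProb₁ π q Q φ))
    (acceptReject (proposal₂ q Q φ J) (acceptProb₂ π q Q φ))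

end Kernels

end MHAAR

end

/-!
The proof reduces everything to the Dirichlet form `ℰ_P(f) = ⟨f, f⟩ - ⟨f, P f⟩` of a reversible
kernel `P`.

*Reversibility.* The acceptance ratio `r̊` is the density of `π(dy) q(y, dx) Q̄_{y,x}(du)` with
respect to `π(dx) q(x, dy) Q_{x,y}(du)` on the set where it is positive
(`withDensity_acceptanceRatio`). One has
`(r̊_k / ∑ᵢ r̊ᵢ) min{1, r̊^N} = N⁻¹ r̊_k min{1, 1 / r̊^N}` (`indexWeight_mul_acceptProb₁`), and `Q^N`
disintegrates as `Q(du⁽ᵏ⁾) Q^N(d𝔲⁽⁻ᵏ⁾ ∣ u⁽ᵏ⁾)`. Hence the flow of accepted moves of the first kind is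
the time reversal of that of the second kind (`acceptedFlow_proposal₁_eq`), so that the mixture is
reversible and its Dirichlet form is `½ ∫ π(dx) q(x, dy) A^N(x, y) (f x - f y)²`, with
`A^N(x, y) = ∫ Q^N_{x,y}(d𝔲) min{1, r̊^N_𝔲(x, y)}` (`dirichletForm_avgKernel`). For the
Metropolis-Hastings kernel the same holds with `A(x, y) = min{1, r(x, y)}`; its reversibility
follows as `A(x, y) π(dx) q(x, dy)` is the infimum of `π(dx) q(x, dy)` and its image under the
exchange of the coordinates (`map_withDensity_min_acceptanceRatio`).

*Comparison of Dirichlet forms.* By Jensen's inequality and `∫ Q_{x,y}(du) r̊_u(x, y) ≤ r(x, y)`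
one has `A^N ≤ A` (`ae_meanAccept_le`). Under exchangeability, averaging `r̊^N` over the cyclic
shifts of the `M` components of `𝔲` gives `r̊^M`, and the concavity of `min{1, ·}` yields
`A^N ≤ A^M` (`meanAccept_mono`).

*Asymptotic variance.* On `L²(π)` a reversible kernel acts as a self-adjoint contraction `T`, and
the variance of `f(X₁) + ⋯ + f(X_n)` is a double partial sum of the autocovariances `⟨f, T^k f⟩`
(`scaledVariance_eq`). The limit of the normalized variances exists since the even autocovariances
decrease and the sums of two successive ones are nonnegative (`exists_tendsto_sumVariance`). It
agrees with the Abel limit `lim_{z ↑ 1} (2 ⟨f, (1 - z T)⁻¹ f⟩ - ⟨f, f⟩)`, and the quadratic form of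
the resolvent is antitone in the one of `1 - T` (`limit_sumVariance_le`); no spectral theorem is
needed.
-/

/-! ### Cesàro and Abel means -/

theorem tendsto_of_tendsto_even_odd {u : ℕ → ℝ} {l : ℝ}
    (h₀ : Tendsto (fun k => u (2 * k)) atTop (𝓝 l))
    (h₁ : Tendsto (fun k => u (2 * k + 1)) atTop (𝓝 l)) : Tendsto u atTop (𝓝 l) := by
  rw [Metric.tendsto_atTop] at *
  intro ε hε
  obtain ⟨a, ha⟩ := h₀ ε hε
  obtain ⟨b, hb⟩ := h₁ ε hε
  refine ⟨2 * max a b + 1, fun n hn => ?_⟩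
  obtain ⟨k, rfl | rfl⟩ := n.even_or_odd'
  · exact ha k (by omega)
  · exact hb k (by omega)

theorem tendsto_cesaro_atTop {u : ℕ → ℝ} (h : Tendsto u atTop atTop) :
    Tendsto (fun n : ℕ => (∑ i ∈ Finset.range n, u i) / n) atTop atTop := by
  rw [tendsto_atTop]
  intro C
  obtain ⟨m, hm⟩ := (tendsto_atTop.1 h (C + 1)).exists_forall_of_atTop
  set K := ∑ i ∈ Finset.range m, u i - (C + 1) * m with hK
  have key : ∀ n, m ≤ n → (C + 1) * n + K ≤ ∑ i ∈ Finset.range n, u i := by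
    intro n hn
    induction n, hn using Nat.le_induction with
    | base => simp [hK]
    | succ n hn ih =>
      rw [Finset.sum_range_succ]
      push_cast
      linarith [hm n hn]
  filter_upwards [eventually_ge_atTop m, eventually_gt_atTop 0,
    eventually_ge_atTop ⌈-K⌉₊] with n hn hn0 hnK
  have hn0' : (0 : ℝ) < n := by exact_mod_cast hn0
  rw [le_div_iff₀ hn0']
  have : -K ≤ n := (Nat.le_ceil _).trans (by exact_mod_cast hnK)
  linarith [key n hn]

/-- Cauchy product with the geometric series: the generating function of the partial sums. -/
theorem summable_tsum_geometric_partialSum {x : ℕ → ℝ} {z : ℝ} (hz₀ : 0 ≤ z) (hz₁ : z < 1)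
    (hx : Summable fun n => ‖x n * z ^ n‖) :
    (Summable fun n => ‖(∑ k ∈ Finset.range (n + 1), x k) * z ^ n‖) ∧
    ∑' n, (∑ k ∈ Finset.range (n + 1), x k) * z ^ n = (∑' n, x n * z ^ n) * (1 - z)⁻¹ := by
  have hg : Summable fun n : ℕ => ‖z ^ n‖ := by
    simpa [abs_of_nonneg hz₀] using summable_geometric_of_lt_one hz₀ hz₁
  have e : (fun n : ℕ => ∑ k ∈ Finset.range (n + 1), x k * z ^ k * z ^ (n - k)) =
      fun n => (∑ k ∈ Finset.range (n + 1), x k) * z ^ n := by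
    funext n
    rw [Finset.sum_mul]
    refine Finset.sum_congr rfl fun k hk => ?_
    rw [mul_assoc, ← pow_add, Nat.add_sub_cancel' (by simpa [Nat.lt_succ_iff] using hk)]
  constructor
  · have := summable_norm_sum_mul_range_of_summable_norm hx hg
    rw [show (fun n => ‖(∑ k ∈ Finset.range (n + 1), x k) * z ^ n‖) =
      fun n => ‖∑ k ∈ Finset.range (n + 1), x k * z ^ k * z ^ (n - k)‖ from
      funext fun n => by rw [← congrFun e n]]
    exact this
  · rw [← e, ← tsum_mul_tsum_eq_tsum_sum_range_of_summable_norm hx hg,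
      tsum_geometric_of_lt_one hz₀ hz₁]

/-- A sequence that eventually grows at a positive linear rate has a positive Abel sum
for some parameter. -/
theorem exists_abel_sum_pos {D : ℕ → ℝ} {ε : ℝ} (hε : 0 < ε) {m : ℕ}
    (hD : ∀ n, m ≤ n → ε * n ≤ D n) :
    ∃ z : ℝ, 0 ≤ z ∧ z < 1 ∧ ((Summable fun n => D n * z ^ n) → 0 < ∑' n, D n * z ^ n) := by
  obtain ⟨K, hK₀, hK⟩ : ∃ K : ℝ, 0 ≤ K ∧ ∀ n, ε * n - K ≤ D n := by
    refine ⟨∑ i ∈ Finset.range m, |ε * i - D i|, by positivity, fun n => ?_⟩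
    rcases le_or_gt m n with h | h
    · have : 0 ≤ ∑ i ∈ Finset.range m, |ε * i - D i| := by positivity
      linarith [hD n h]
    · have := Finset.single_le_sum (f := fun i : ℕ => |ε * i - D i|) (fun i _ => abs_nonneg _)
        (Finset.mem_range.2 h)
      linarith [le_abs_self (ε * n - D n)]
  -- `D` has Abel sum at least `(ε z - K (1 - z)) / (1 - z)²`, positive as soon as
  -- `z > K / (ε + K)`
  set z := (K + 1) / (ε + K + 1) with hz
  have hden : 0 < ε + K + 1 := by positivity
  have hz₀ : 0 ≤ z := by positivity
  have hz' : 1 - z = ε / (ε + K + 1) := by rw [hz]; field_simp; ring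
  have hz₁ : z < 1 := by
    have : 0 < 1 - z := by rw [hz']; positivity
    linarith
  refine ⟨z, hz₀, hz₁, fun hs => ?_⟩
  have hn : ‖z‖ < 1 := by rwa [Real.norm_eq_abs, abs_of_nonneg hz₀]
  have h := ((hasSum_coe_mul_geometric_of_norm_lt_one hn).mul_left ε).sub
    ((hasSum_geometric_of_lt_one hz₀ hz₁).mul_left K)
  refine lt_of_lt_of_le ?_ (hasSum_le (fun n => ?_) h hs.hasSum)
  · have h1 : 0 < 1 - z := by linarith
    have : ε * (z / (1 - z) ^ 2) - K * (1 - z)⁻¹ = (ε * z - K * (1 - z)) / (1 - z) ^ 2 := by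
      field_simp
    rw [this]
    refine div_pos ?_ (by positivity)
    rw [hz', hz]
    have : ε * ((K + 1) / (ε + K + 1)) - K * (ε / (ε + K + 1)) = ε / (ε + K + 1) := by
      field_simp; ring
    rw [this]; positivity
  · have := mul_le_mul_of_nonneg_right (hK n) (pow_nonneg hz₀ n)
    linarith

/-! ### Self-adjoint contractions of a real Hilbert space -/

section Hilbert

variable {H : Type*} [NormedAddCommGroup H] [InnerProductSpace ℝ H]

local notation "⟪" x ", " y "⟫" => inner ℝ x y

/-- The symmetric sum `∑_{|k| ≤ n} ⟨f, T^{|k|} f⟩` of autocovariances. -/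
noncomputable def autocovSum (T : H →L[ℝ] H) (f : H) (n : ℕ) : ℝ :=
  -⟪f, f⟫ + 2 * ∑ k ∈ Finset.range (n + 1), ⟪f, (T ^ k) f⟫

/-- The variance of a sum of `n` consecutive terms of a stationary process with autocovariances
`⟨f, T^k f⟩`. -/
noncomputable def sumVariance (T : H →L[ℝ] H) (f : H) (n : ℕ) : ℝ :=
  ∑ m ∈ Finset.range n, autocovSum T f m

variable {T : H →L[ℝ] H} {f : H}

theorem inner_pow_apply_left (hT : ∀ x y, ⟪T x, y⟫ = ⟪x, T y⟫) (k : ℕ) :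
    ∀ x y, ⟪(T ^ k) x, y⟫ = ⟪x, (T ^ k) y⟫ := by
  induction k with
  | zero => simp
  | succ k ih =>
    intro x y
    rw [pow_succ, mul_apply_eq_comp, ih, hT, ← mul_apply_eq_comp,
      ← pow_succ', pow_succ]

theorem inner_pow_even (hT : ∀ x y, ⟪T x, y⟫ = ⟪x, T y⟫) (k : ℕ) :
    ⟪f, (T ^ (2 * k)) f⟫ = ‖(T ^ k) f‖ ^ 2 := by
  rw [two_mul, pow_add, mul_apply_eq_comp, ← inner_pow_apply_left hT,
    real_inner_self_eq_norm_sq]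

theorem inner_pow_odd (hT : ∀ x y, ⟪T x, y⟫ = ⟪x, T y⟫) (k : ℕ) :
    ⟪f, (T ^ (2 * k + 1)) f⟫ = ⟪(T ^ k) f, T ((T ^ k) f)⟫ := by
  rw [show 2 * k + 1 = k + (k + 1) by ring, pow_add, mul_apply_eq_comp,
    ← inner_pow_apply_left hT, pow_succ', mul_apply_eq_comp]

theorem norm_apply_le_of_norm_le_one (hT₁ : ‖T‖ ≤ 1) (x : H) : ‖T x‖ ≤ ‖x‖ := by
  simpa using T.le_of_opNorm_le hT₁ x

theorem inner_pow_even_add_odd_nonneg (hT : ∀ x y, ⟪T x, y⟫ = ⟪x, T y⟫) (hT₁ : ‖T‖ ≤ 1) (k : ℕ) :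
    0 ≤ ⟪f, (T ^ (2 * k)) f⟫ + ⟪f, (T ^ (2 * k + 1)) f⟫ := by
  rw [inner_pow_even hT, inner_pow_odd hT]
  have h1 := abs_real_inner_le_norm ((T ^ k) f) (T ((T ^ k) f))
  have h2 := norm_apply_le_of_norm_le_one hT₁ ((T ^ k) f)
  nlinarith [neg_abs_le (⟪(T ^ k) f, T ((T ^ k) f)⟫), norm_nonneg ((T ^ k) f)]

theorem antitone_norm_pow_apply (hT₁ : ‖T‖ ≤ 1) : Antitone fun k => ‖(T ^ k) f‖ ^ 2 := by
  refine antitone_nat_of_succ_le fun k => ?_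
  have h : (T ^ (k + 1)) f = T ((T ^ k) f) := by rw [pow_succ', mul_apply_eq_comp]
  simp only [h]
  gcongr
  exact norm_apply_le_of_norm_le_one hT₁ _

theorem autocovSum_succ (n : ℕ) :
    autocovSum T f (n + 1) = autocovSum T f n + 2 * ⟪f, (T ^ (n + 1)) f⟫ := by
  simp only [autocovSum]
  rw [Finset.sum_range_succ _ (n + 1)]
  ring

/-- The variances of normalized sums converge in `[0, ∞]`. The autocovariances of even order
decrease to a limit `L ≥ 0` and the sums of two consecutive ones (starting at an even order) are
nonnegative, so that the partial sums of the autocovariances, corrected by `±L`, have a limit. -/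
theorem exists_tendsto_sumVariance (hT : ∀ x y, ⟪T x, y⟫ = ⟪x, T y⟫) (hT₁ : ‖T‖ ≤ 1) :
    ∃ c : ℝ≥0∞, Tendsto (fun n : ℕ => ENNReal.ofReal (sumVariance T f n / n)) atTop (𝓝 c) := by
  obtain ⟨L, hL⟩ : ∃ L, Tendsto (fun k => ‖(T ^ k) f‖ ^ 2) atTop (𝓝 L) :=
    ⟨_, tendsto_atTop_ciInf (antitone_norm_pow_apply hT₁) ⟨0, by rintro _ ⟨k, rfl⟩; positivity⟩⟩
  have hodd : ∀ k, autocovSum T f (2 * k + 1 + 1) =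
      autocovSum T f (2 * k + 1) + 2 * ‖(T ^ (k + 1)) f‖ ^ 2 := fun k => by
    rw [autocovSum_succ, ← inner_pow_even hT]; rfl
  have hmono : Monotone fun k => autocovSum T f (2 * k + 1) := by
    refine monotone_nat_of_le_succ fun k => ?_
    have h := inner_pow_even_add_odd_nonneg (f := f) hT hT₁ (k + 1)
    have h1 := autocovSum_succ (T := T) (f := f) (2 * k + 1)
    have h2 := autocovSum_succ (T := T) (f := f) (2 * k + 1 + 1)
    rw [show 2 * (k + 1) = 2 * k + 1 + 1 by ring] at h ⊢
    linarith
  rcases tendsto_atTop_of_monotone hmono with h | ⟨o, ho⟩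
  · have hs : Tendsto (autocovSum T f) atTop atTop := by
      rw [tendsto_atTop] at *
      intro C
      obtain ⟨a, ha⟩ := (h C).exists_forall_of_atTop
      filter_upwards [eventually_ge_atTop (2 * a + 2)] with n hn
      obtain ⟨k, rfl | rfl⟩ := n.even_or_odd'
      · obtain ⟨j, rfl⟩ : ∃ j, k = j + 1 := ⟨k - 1, by omega⟩
        have := ha j (by omega)
        rw [show 2 * (j + 1) = 2 * j + 1 + 1 by ring, hodd]
        linarith [sq_nonneg ‖(T ^ (j + 1)) f‖]
      · exact ha k (by omega)
    exact ⟨_, ENNReal.tendsto_ofReal_atTop.comp (tendsto_cesaro_atTop hs)⟩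
  · have h1 : Tendsto (fun n => autocovSum T f n - (-1) ^ n * L) atTop (𝓝 (o + L)) := by
      refine tendsto_of_tendsto_even_odd ?_ ?_
      · rw [← tendsto_add_atTop_iff_nat 1]
        have := (ho.add ((hL.comp (tendsto_add_atTop_nat 1)).const_mul 2)).sub_const L
        refine (this.congr fun k => ?_).trans (by rw [show o + 2 * L - L = o + L by ring])
        rw [pow_mul, show 2 * (k + 1) = 2 * k + 1 + 1 by ring, hodd]
        simp
      · refine (ho.add_const L).congr fun k => ?_
        rw [pow_succ, pow_mul]; simp
    have h2 : Tendsto (fun n : ℕ => (n : ℝ)⁻¹ * ∑ i ∈ Finset.range n, (-1) ^ i * L) atTop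
        (𝓝 0) := by
      have : ∀ n : ℕ, ‖(n : ℝ)⁻¹ * ∑ i ∈ Finset.range n, (-1) ^ i * L‖ ≤ |L| / n := fun n => by
        rw [← Finset.sum_mul, neg_one_geom_sum, norm_mul, norm_mul, norm_inv, Real.norm_natCast,
          div_eq_inv_mul]
        gcongr
        split_ifs <;> simp
      exact squeeze_zero_norm this (tendsto_const_div_atTop_nhds_zero_nat _)
    refine ⟨_, ENNReal.tendsto_ofReal (a := o + L + 0) ((h1.cesaro.add h2).congr fun n => ?_)⟩
    rw [← mul_add, ← Finset.sum_add_distrib, sumVariance, div_eq_inv_mul]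
    simp

/-- The quadratic form of the resolvent is monotone in the quadratic form of the operator. -/
theorem resolvent_form_le {T₁ T₂ : H →L[ℝ] H} (hT₁ : ∀ x y, ⟪T₁ x, y⟫ = ⟪x, T₁ y⟫)
    (hT₁' : ‖T₁‖ ≤ 1) (hle : ∀ x, ⟪x, T₂ x⟫ ≤ ⟪x, T₁ x⟫) {z : ℝ} (hz₀ : 0 ≤ z) (hz₁ : z < 1)
    {h₁ h₂ : H} (e₁ : h₁ - z • T₁ h₁ = f) (e₂ : h₂ - z • T₂ h₂ = f) :
    ⟪f, h₂⟫ ≤ ⟪f, h₁⟫ := by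
  -- positivity of the form of `1 - z T₁` at `h₁ - h₂`
  have hpos : 0 ≤ ⟪h₁ - h₂, (h₁ - h₂) - z • T₁ (h₁ - h₂)⟫ := by
    rw [inner_sub_right, inner_smul_right, real_inner_self_eq_norm_sq]
    have h1 := real_inner_le_norm (h₁ - h₂) (T₁ (h₁ - h₂))
    have h2 := norm_apply_le_of_norm_le_one hT₁' (h₁ - h₂)
    have h3 : ⟪h₁ - h₂, T₁ (h₁ - h₂)⟫ ≤ ‖h₁ - h₂‖ ^ 2 := by
      nlinarith [norm_nonneg (h₁ - h₂)]
    nlinarith [mul_le_mul_of_nonneg_left h3 hz₀, sq_nonneg ‖h₁ - h₂‖]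
  have h4 : ⟪h₁, z • T₁ h₂⟫ = ⟪h₁ - f, h₂⟫ := by
    rw [← e₁, sub_sub_cancel, inner_smul_left, inner_smul_right, hT₁]; rfl
  have h5 : ⟪h₂, z • T₂ h₂⟫ = ⟪h₂, h₂ - f⟫ := by rw [← e₂, sub_sub_cancel]
  have h6 : ⟪h₂, z • T₂ h₂⟫ ≤ ⟪h₂, z • T₁ h₂⟫ := by
    rw [inner_smul_right, inner_smul_right]
    exact mul_le_mul_of_nonneg_left (hle _) hz₀
  have h7 : (h₁ - h₂) - z • T₁ (h₁ - h₂) = f - h₂ + z • T₁ h₂ := by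
    rw [← e₁, map_sub, smul_sub]; abel
  rw [h7] at hpos
  simp only [inner_add_right, inner_sub_left, inner_sub_right, real_inner_comm f] at *
  linarith

variable [CompleteSpace H]

/-- The Abel sum of the autocovariances is a quadratic form in the resolvent. -/
theorem exists_resolvent (hT₁ : ‖T‖ ≤ 1) {z : ℝ} (hz₀ : 0 ≤ z) (hz₁ : z < 1) :
    ∃ h : H, h - z • T h = f ∧ (Summable fun n => ‖⟪f, (T ^ n) f⟫ * z ^ n‖) ∧
      ∑' n, ⟪f, (T ^ n) f⟫ * z ^ n = ⟪f, h⟫ := by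
  have hn : ‖z • T‖ < 1 := by
    rw [norm_smul, Real.norm_eq_abs, abs_of_nonneg hz₀]
    nlinarith
  have hs : HasSum (fun n => ⟪f, (T ^ n) f⟫ * z ^ n) ⟪f, (∑' n, (z • T) ^ n) f⟫ := by
    have h1 := ((ContinuousLinearMap.apply ℝ H f).hasSum
      (summable_geometric_of_norm_lt_one hn).hasSum)
    have h2 := (innerSL ℝ f).hasSum h1
    simpa [smul_pow, inner_smul_right, mul_comm] using h2
  refine ⟨(∑' n, (z • T) ^ n) f, ?_, ?_, hs.tsum_eq⟩
  · have := congrArg (fun S : H →L[ℝ] H => S f) (mul_neg_geom_series (z • T) hn)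
    simpa [sub_mul] using this
  · exact hs.summable.norm

theorem summable_tsum_sumVariance (hT₁ : ‖T‖ ≤ 1) {z : ℝ} (hz₀ : 0 ≤ z) (hz₁ : z < 1) :
    (Summable fun n => ‖sumVariance T f (n + 1) * z ^ n‖) ∧
      ∑' n, sumVariance T f (n + 1) * z ^ n =
        (2 * ∑' n, ⟪f, (T ^ n) f⟫ * z ^ n - ⟪f, f⟫) * (1 - z)⁻¹ * (1 - z)⁻¹ := by
  obtain ⟨h, -, hs, -⟩ := exists_resolvent (f := f) hT₁ hz₀ hz₁
  -- `autocovSum` consists of the partial sums of `x`, and `sumVariance` of the partial sums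
  -- of `autocovSum`
  set x : ℕ → ℝ := fun n => 2 * ⟪f, (T ^ n) f⟫ - (if n = 0 then ⟪f, f⟫ else 0) with hx
  have hx_sum : HasSum (fun n => x n * z ^ n) (2 * ∑' n, ⟪f, (T ^ n) f⟫ * z ^ n - ⟪f, f⟫) := by
    have h1 := (hs.of_norm.hasSum.mul_left 2).sub (hasSum_ite_eq (0 : ℕ) ⟪f, f⟫)
    have e : (fun n => x n * z ^ n) =
        fun n => 2 * (⟪f, (T ^ n) f⟫ * z ^ n) - if n = 0 then ⟪f, f⟫ else 0 := by
      funext n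
      rcases n with _ | n
      · simp [hx]
      · simp [hx, mul_assoc]
    rwa [e]
  have e : ∀ n, ∑ k ∈ Finset.range (n + 1), x k = autocovSum T f n := fun n => by
    rw [hx, Finset.sum_sub_distrib, ← Finset.mul_sum, Finset.sum_ite_eq', autocovSum]
    simp; ring
  obtain ⟨s1, t1⟩ := summable_tsum_geometric_partialSum hz₀ hz₁ hx_sum.summable.norm
  obtain ⟨s2, t2⟩ := summable_tsum_geometric_partialSum hz₀ hz₁ s1
  simp only [e] at s1 t1 s2 t2
  exact ⟨s2, by rw [← hx_sum.tsum_eq, ← t1]; exact t2⟩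

/-- The asymptotic variance is antitone in the quadratic form of the operator `1 - T`: compare the
Abel means, which are given by the resolvents. -/
theorem limit_sumVariance_le {T₁ T₂ : H →L[ℝ] H} (hT₁ : ∀ x y, ⟪T₁ x, y⟫ = ⟪x, T₁ y⟫)
    (hT₁' : ‖T₁‖ ≤ 1) (hT₂' : ‖T₂‖ ≤ 1) (hle : ∀ x, ⟪x, T₂ x⟫ ≤ ⟪x, T₁ x⟫) {c₁ c₂ : ℝ≥0∞}
    (h₁ : Tendsto (fun n : ℕ => ENNReal.ofReal (sumVariance T₁ f n / n)) atTop (𝓝 c₁))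
    (h₂ : Tendsto (fun n : ℕ => ENNReal.ofReal (sumVariance T₂ f n / n)) atTop (𝓝 c₂)) :
    c₂ ≤ c₁ := by
  by_contra! hlt
  obtain ⟨C, hC₁, hC₂⟩ := ENNReal.lt_iff_exists_nnreal_btwn.1 hlt
  obtain ⟨b, hb₁, hb₂⟩ := ENNReal.lt_iff_exists_nnreal_btwn.1 hC₂
  have hCb : (C : ℝ) < b := by exact_mod_cast hb₁
  obtain ⟨m, hm⟩ := ((h₁.eventually_lt_const hC₁).and
    ((h₂.eventually_const_lt hb₂).and (eventually_gt_atTop 0))).exists_forall_of_atTop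
  have hD : ∀ n, m ≤ n → (b - C : ℝ) * n ≤ sumVariance T₂ f (n + 1) - sumVariance T₁ f (n + 1) := by
    intro n hn
    obtain ⟨g1, g2, -⟩ := hm (n + 1) (by omega)
    have hpos : (0 : ℝ) < (n + 1 : ℕ) := by positivity
    have k1 : sumVariance T₁ f (n + 1) / (n + 1 : ℕ) < C := by
      rw [← ENNReal.ofReal_coe_nnreal] at g1
      exact (ENNReal.ofReal_lt_ofReal_iff'.1 g1).1
    have k2 : b < sumVariance T₂ f (n + 1) / (n + 1 : ℕ) := by
      rw [← ENNReal.ofReal_coe_nnreal] at g2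
      exact (ENNReal.ofReal_lt_ofReal_iff_of_nonneg b.2).1 g2
    rw [div_lt_iff₀ hpos] at k1
    rw [lt_div_iff₀ hpos] at k2
    push_cast at k1 k2
    nlinarith
  obtain ⟨z, hz₀, hz₁, hz⟩ := exists_abel_sum_pos (sub_pos.2 hCb) hD
  obtain ⟨r₁, e₁, -, t₁⟩ := exists_resolvent (f := f) hT₁' hz₀ hz₁
  obtain ⟨r₂, e₂, -, t₂⟩ := exists_resolvent (f := f) hT₂' hz₀ hz₁
  obtain ⟨s₁, v₁⟩ := summable_tsum_sumVariance (f := f) hT₁' hz₀ hz₁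
  obtain ⟨s₂, v₂⟩ := summable_tsum_sumVariance (f := f) hT₂' hz₀ hz₁
  have hs := s₂.of_norm.sub s₁.of_norm
  simp only [← sub_mul] at hs
  have hpos := hz hs
  simp only [sub_mul] at hpos
  rw [s₂.of_norm.tsum_sub s₁.of_norm, v₁, v₂, t₁, t₂] at hpos
  have := resolvent_form_le hT₁ hT₁' hle hz₀ hz₁ e₁ e₂
  have hz' : 0 < (1 - z)⁻¹ := inv_pos.2 (by linarith)
  have : (2 * ⟪f, r₂⟫ - ⟪f, f⟫) * (1 - z)⁻¹ * (1 - z)⁻¹ ≤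
      (2 * ⟪f, r₁⟫ - ⟪f, f⟫) * (1 - z)⁻¹ * (1 - z)⁻¹ := by gcongr
  linarith

end Hilbert

namespace MHAAR

/-! ### The transition operator of a reversible kernel -/

section Operator

variable {E : Type*} [MeasurableSpace E] {μ : Measure E} {P : Kernel E E}

theorem integral_comp_measurePreserving {F : Type*} [MeasurableSpace F] {ν : Measure F} {g : F → E}
    (hg : MeasurePreserving g ν μ) {f : E → ℝ} (hf : AEStronglyMeasurable f μ) :
    ∫ x, f (g x) ∂ν = ∫ y, f y ∂μ := by
  have h := integral_map (μ := ν) hg.aemeasurable (f := f) (by rwa [hg.map_eq])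
  rw [hg.map_eq] at h
  exact h.symm

theorem inner_toLp {f g : E → ℝ} (hf : MemLp f 2 μ) (hg : MemLp g 2 μ) :
    inner ℝ (hf.toLp f) (hg.toLp g) = ∫ x, f x * g x ∂μ := by
  rw [L2.inner_def]
  refine integral_congr_ae ?_
  filter_upwards [hf.coeFn_toLp, hg.coeFn_toLp] with x h1 h2
  rw [h1, h2]
  simp [mul_comm]

theorem measurePreserving_fst_compProd [SFinite μ] [IsMarkovKernel P] :
    MeasurePreserving Prod.fst (μ ⊗ₘ P) μ :=
  ⟨measurable_fst, Measure.fst_compProd μ P⟩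

theorem measurePreserving_snd_compProd [SFinite μ] [IsSFiniteKernel P] (hP : P.Invariant μ) :
    MeasurePreserving Prod.snd (μ ⊗ₘ P) μ :=
  ⟨measurable_snd, (Measure.snd_compProd μ P).trans hP⟩

theorem measurePreserving_swap_compProd [IsFiniteMeasure μ] [IsMarkovKernel P]
    (hP : P.IsReversible μ) : MeasurePreserving Prod.swap (μ ⊗ₘ P) (μ ⊗ₘ P) := by
  refine ⟨measurable_swap, ?_⟩
  rw [Measure.ext_prod_iff]
  intro s t hs ht
  rw [Measure.map_apply measurable_swap (hs.prod ht), Set.preimage_swap_prod,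
    Measure.compProd_apply_prod ht hs, Measure.compProd_apply_prod hs ht, hP ht hs]

variable [IsProbabilityMeasure μ] [IsMarkovKernel P]

/-- The operator `f ↦ ∫ f(y) P(·, dy)` on `L²(μ)`, for an invariant distribution `μ`. With `J₁` and
`J₂` the isometric embeddings `f ↦ f(X₀)`, `f ↦ f(X₁)`, it is `J₁† J₂`. -/
noncomputable def transitionOp (hP : P.Invariant μ) : Lp ℝ 2 μ →L[ℝ] Lp ℝ 2 μ :=
  ContinuousLinearMap.adjoint (Lp.compMeasurePreservingₗᵢ ℝ (p := 2) (E := ℝ) (Prod.fst : E × E → E)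
      (measurePreserving_fst_compProd (μ := μ) (P := P))).toContinuousLinearMap ∘L
    (Lp.compMeasurePreservingₗᵢ ℝ Prod.snd
      (measurePreserving_snd_compProd hP)).toContinuousLinearMap

theorem norm_transitionOp_le (hP : P.Invariant μ) : ‖transitionOp hP‖ ≤ 1 := by
  refine (ContinuousLinearMap.opNorm_comp_le _ _).trans ?_
  rw [LinearIsometryEquiv.norm_map]
  exact mul_le_one₀ (LinearIsometry.norm_toContinuousLinearMap_le _) (norm_nonneg _)
    (LinearIsometry.norm_toContinuousLinearMap_le _)

theorem inner_transitionOp (hP : P.Invariant μ) (g f : Lp ℝ 2 μ) :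
    inner ℝ g (transitionOp hP f) = ∫ p, g p.1 * f p.2 ∂(μ ⊗ₘ P) := by
  rw [transitionOp, ContinuousLinearMap.comp_apply, ContinuousLinearMap.adjoint_inner_right,
    L2.inner_def]
  refine integral_congr_ae ?_
  filter_upwards [Lp.coeFn_compMeasurePreserving g (measurePreserving_fst_compProd (P := P)),
    Lp.coeFn_compMeasurePreserving f (measurePreserving_snd_compProd hP)] with p h1 h2
  change inner ℝ (Lp.compMeasurePreserving _ _ g p) (Lp.compMeasurePreserving _ _ f p) = _
  rw [h1, h2]
  simp [mul_comm]

theorem transitionOp_symm (hP : P.IsReversible μ) (f g : Lp ℝ 2 μ) :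
    inner ℝ (transitionOp hP.invariant f) g = inner ℝ f (transitionOp hP.invariant g) := by
  rw [real_inner_comm, inner_transitionOp, inner_transitionOp,
    ← (measurePreserving_swap_compProd hP).integral_comp
      (MeasurableEquiv.prodComm (α := E) (β := E)).measurableEmbedding]
  simp [mul_comm]

theorem transitionOp_coeFn (hP : P.Invariant μ) (f : Lp ℝ 2 μ) :
    transitionOp hP f =ᵐ[μ] fun x => ∫ y, f y ∂(P x) := by
  have hf : Integrable (fun p : E × E => f p.2) (μ ⊗ₘ P) :=
    ((measurePreserving_snd_compProd hP).integrable_comp_of_integrable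
      ((Lp.memLp f).integrable (by norm_num)))
  have hf' : Integrable (fun x => ∫ y, f y ∂(P x)) μ := by
    rw [Measure.compProd] at hf
    exact hf.integral_compProd
  refine Integrable.ae_eq_of_forall_setIntegral_eq _ _
    ((Lp.memLp _).integrable (by norm_num)) hf' fun s hs _ => ?_
  have h := inner_transitionOp hP (indicatorConstLp 2 hs (measure_ne_top μ s) 1) f
  rw [L2.inner_indicatorConstLp_one] at h
  rw [h, ← integral_indicator hs]
  have e : ∀ᵐ p ∂(μ ⊗ₘ P), (indicatorConstLp 2 hs (measure_ne_top μ s) (1 : ℝ) : E → ℝ) p.1 * f p.2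
      = (Prod.fst ⁻¹' s).indicator (fun p : E × E => f p.2) p := by
    filter_upwards [(measurePreserving_fst_compProd (μ := μ) (P := P)).quasiMeasurePreserving.ae
      (indicatorConstLp_coeFn (p := 2) (hs := hs) (hμs := measure_ne_top μ s) (c := (1 : ℝ)))]
      with p hp
    rw [hp]
    by_cases h : p.1 ∈ s <;> simp [h]
  rw [integral_congr_ae e, Measure.integral_compProd (hf.indicator (measurable_fst hs))]
  refine integral_congr_ae (Eventually.of_forall fun x => ?_)
  by_cases h : x ∈ s <;> simp [Set.indicator, h]

/-! ### Dirichlet form and autocovariance in terms of the transition operator -/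

theorem inner_transitionOp_toLp (hP : P.Invariant μ) {f g : E → ℝ} (hf : MemLp f 2 μ)
    (hg : MemLp g 2 μ) :
    inner ℝ (hf.toLp f) (transitionOp hP (hg.toLp g)) = ∫ p, f p.1 * g p.2 ∂(μ ⊗ₘ P) := by
  rw [inner_transitionOp]
  refine integral_congr_ae ?_
  filter_upwards [measurePreserving_fst_compProd.quasiMeasurePreserving.ae hf.coeFn_toLp,
    (measurePreserving_snd_compProd hP).quasiMeasurePreserving.ae hg.coeFn_toLp] with p h1 h2
  rw [h1, h2]

theorem lintegral_compProd_of_invariant (hP : P.Invariant μ) {f : E → ℝ}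
    (hf : AEStronglyMeasurable f μ) :
    ∫⁻ x, ∫⁻ y, ENNReal.ofReal ((f x - f y) ^ 2) ∂(P x) ∂μ =
      ∫⁻ p, ENNReal.ofReal ((f p.1 - f p.2) ^ 2) ∂(μ ⊗ₘ P) := by
  have h1 := measurePreserving_fst_compProd (P := P).quasiMeasurePreserving.ae hf.ae_eq_mk
  have h2 := (measurePreserving_snd_compProd hP).quasiMeasurePreserving.ae hf.ae_eq_mk
  have h : ∀ᵐ p ∂(μ ⊗ₘ P), ENNReal.ofReal ((f p.1 - f p.2) ^ 2) =
      ENNReal.ofReal ((hf.mk f p.1 - hf.mk f p.2) ^ 2) := by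
    filter_upwards [h1, h2] with p h1 h2
    rw [h1, h2]
  have hm := hf.stronglyMeasurable_mk.measurable
  rw [lintegral_congr_ae h, Measure.lintegral_compProd (by fun_prop)]
  refine lintegral_congr_ae ?_
  filter_upwards [Measure.ae_ae_of_ae_compProd h] with x hx
  exact lintegral_congr_ae hx

theorem dirichletForm_eq (hP : P.Invariant μ) {f : E → ℝ} (hf : MemLp f 2 μ) :
    dirichletForm μ P f = ENNReal.ofReal (inner ℝ (hf.toLp f) (hf.toLp f) -
      inner ℝ (hf.toLp f) (transitionOp hP (hf.toLp f))) := by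
  have h1 := hf.comp_measurePreserving (measurePreserving_fst_compProd (μ := μ) (P := P))
  have h2 := hf.comp_measurePreserving (measurePreserving_snd_compProd hP)
  have h3 : ∫ p, (f p.1 - f p.2) ^ 2 ∂(μ ⊗ₘ P) = 2 * (inner ℝ (hf.toLp f) (hf.toLp f) -
      inner ℝ (hf.toLp f) (transitionOp hP (hf.toLp f))) := by
    have e1 : ∫ p, f p.1 * f p.1 ∂(μ ⊗ₘ P) = ∫ x, f x * f x ∂μ :=
      integral_comp_measurePreserving (f := fun x => f x * f x) measurePreserving_fst_compProd
        (hf.1.mul hf.1)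
    have e2 : ∫ p, f p.2 * f p.2 ∂(μ ⊗ₘ P) = ∫ x, f x * f x ∂μ :=
      integral_comp_measurePreserving (f := fun x => f x * f x)
        (measurePreserving_snd_compProd hP) (hf.1.mul hf.1)
    rw [inner_toLp, inner_transitionOp_toLp]
    have i1 : Integrable (fun p : E × E => f p.1 * f p.1) (μ ⊗ₘ P) := h1.integrable_mul h1
    have i2 : Integrable (fun p : E × E => f p.2 * f p.2) (μ ⊗ₘ P) := h2.integrable_mul h2
    have i3 : Integrable (fun p : E × E => f p.1 * f p.2) (μ ⊗ₘ P) := h1.integrable_mul h2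
    have : ∀ p : E × E, (f p.1 - f p.2) ^ 2 =
        (f p.1 * f p.1 + f p.2 * f p.2) - 2 * (f p.1 * f p.2) := fun p => by ring
    simp_rw [this]
    have i4 : Integrable (fun p : E × E => f p.1 * f p.1 + f p.2 * f p.2) (μ ⊗ₘ P) := i1.add i2
    rw [integral_sub i4 (i3.const_mul 2), integral_add i1 i2, integral_const_mul, e1, e2]
    ring
  rw [dirichletForm, lintegral_compProd_of_invariant hP hf.1,
    ← ofReal_integral_eq_lintegral_ofReal (f := fun p : E × E => (f p.1 - f p.2) ^ 2)
      (h1.sub h2).integrable_sq (Eventually.of_forall fun p => sq_nonneg _), h3,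
    ENNReal.ofReal_mul (by norm_num),
    ENNReal.ofReal_ofNat, ← mul_assoc, ENNReal.inv_mul_cancel (by simp) (by simp), one_mul]

theorem inner_transitionOp_le (hP : P.Invariant μ) (F : Lp ℝ 2 μ) :
    inner ℝ F (transitionOp hP F) ≤ inner ℝ F F := by
  have h1 := real_inner_le_norm F (transitionOp hP F)
  have h2 := norm_apply_le_of_norm_le_one (norm_transitionOp_le hP) F
  rw [real_inner_self_eq_norm_sq]
  nlinarith [norm_nonneg F]

theorem autocovariance_eq (hP : P.Invariant μ) {f : E → ℝ} (hf : MemLp f 2 μ) :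
    autocovariance μ P f =
      inner ℝ (hf.toLp f) (transitionOp hP (hf.toLp f)) - (∫ x, f x ∂μ) ^ 2 := by
  have h1 := hf.comp_measurePreserving (measurePreserving_fst_compProd (μ := μ) (P := P))
  have h2 := hf.comp_measurePreserving (measurePreserving_snd_compProd hP)
  have e1 : ∫ p, f p.1 ∂(μ ⊗ₘ P) = ∫ x, f x ∂μ :=
    integral_comp_measurePreserving measurePreserving_fst_compProd hf.1
  have e2 : ∫ p, f p.2 ∂(μ ⊗ₘ P) = ∫ x, f x ∂μ :=
    integral_comp_measurePreserving (measurePreserving_snd_compProd hP) hf.1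
  rw [autocovariance, inner_transitionOp_toLp, sq]
  refine (covariance_eq_sub h1 h2).trans ?_
  simp only [Pi.mul_apply, Function.comp_apply, e1, e2]

end Operator

/-! ### Variances of sums along a stationary reversible chain -/

section Path

variable {E : Type*} [MeasurableSpace E] {μ : Measure E} [IsProbabilityMeasure μ] {P : Kernel E E}
  [IsMarkovKernel P]

theorem measurable_snoc (n : ℕ) :
    Measurable fun p : (Fin n → E) × E => Fin.snoc (α := fun _ => E) p.1 p.2 := by
  refine measurable_pi_iff.2 fun i => ?_
  induction i using Fin.lastCases with
  | last => simpa using measurable_snd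
  | cast i => simpa [Function.comp_def] using (measurable_pi_apply i).comp measurable_fst

instance isProbabilityMeasure_pathLaw (n : ℕ) : IsProbabilityMeasure (pathLaw μ P n) := by
  induction n with
  | zero => exact Measure.isProbabilityMeasure_map (by fun_prop)
  | succ n ih => exact Measure.isProbabilityMeasure_map (measurable_snoc _).aemeasurable

/-- The law of `((X₀, …, X_n), X_{n+1})`. -/
noncomputable def stepLaw (μ : Measure E) (P : Kernel E E) (n : ℕ) :
    Measure ((Fin (n + 1) → E) × E) :=
  (pathLaw μ P n) ⊗ₘ
    (P.comap (fun ω : Fin (n + 1) → E => ω (Fin.last n)) (measurable_pi_apply _))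

instance isProbabilityMeasure_stepLaw (n : ℕ) : IsProbabilityMeasure (stepLaw μ P n) := by
  unfold stepLaw; infer_instance

omit [IsProbabilityMeasure μ] [IsMarkovKernel P] in
theorem measurePreserving_snoc (n : ℕ) : MeasurePreserving
    (fun p : (Fin (n + 1) → E) × E => Fin.snoc (α := fun _ => E) p.1 p.2) (stepLaw μ P n)
    (pathLaw μ P (n + 1)) :=
  ⟨measurable_snoc _, rfl⟩

theorem measurePreserving_last (hP : P.Invariant μ) (n : ℕ) :
    MeasurePreserving (fun ω : Fin (n + 1) → E => ω (Fin.last n)) (pathLaw μ P n) μ := by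
  refine ⟨measurable_pi_apply _, ?_⟩
  induction n with
  | zero =>
    rw [pathLaw, Measure.map_map (by fun_prop) (by fun_prop)]
    exact Measure.map_id
  | succ n ih =>
    rw [pathLaw, Measure.map_map (by fun_prop) (measurable_snoc _)]
    have : (fun ω : Fin (n + 1 + 1) → E => ω (Fin.last (n + 1))) ∘
        (fun p : (Fin (n + 1) → E) × E => Fin.snoc (α := fun _ => E) p.1 p.2) = Prod.snd := by
      funext p; simp
    rw [this]
    change Measure.snd _ = μ
    rw [Measure.snd_compProd]
    ext s hs
    rw [Measure.bind_apply hs (Kernel.aemeasurable _)]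
    simp only [Kernel.comap_apply]
    rw [← lintegral_map (f := fun x => P x s) (P.measurable_coe hs) (by fun_prop), ih,
      ← Measure.bind_apply hs (Kernel.aemeasurable _)]
    exact congrArg (· s) hP

theorem measurePreserving_stepLaw_fst (n : ℕ) :
    MeasurePreserving Prod.fst (stepLaw μ P n) (pathLaw μ P n) := by
  exact ⟨measurable_fst, Measure.fst_compProd _ _⟩

theorem measurePreserving_stepLaw_snd (hP : P.Invariant μ) (n : ℕ) :
    MeasurePreserving Prod.snd (stepLaw μ P n) μ := by
  convert (measurePreserving_last hP (n + 1)).comp (measurePreserving_snoc n) using 1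
  funext p; simp

/-- The Markov property, for square integrable functions. -/
theorem integral_stepLaw_mul (hP : P.Invariant μ) (n : ℕ) {h : (Fin (n + 1) → E) → ℝ}
    (hh : MemLp h 2 (pathLaw μ P n)) (g : Lp ℝ 2 μ) :
    ∫ p, h p.1 * g p.2 ∂(stepLaw μ P n) =
      ∫ ω, h ω * transitionOp hP g (ω (Fin.last n)) ∂(pathLaw μ P n) := by
  have h1 := hh.comp_measurePreserving (measurePreserving_stepLaw_fst (P := P) n)
  have h2 := (Lp.memLp g).comp_measurePreserving (measurePreserving_stepLaw_snd hP n)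
  have h3 : Integrable (fun p : (Fin (n + 1) → E) × E => h p.1 * g p.2) (stepLaw μ P n) :=
    h1.integrable_mul h2
  rw [stepLaw, Measure.integral_compProd h3]
  refine integral_congr_ae ?_
  filter_upwards [(measurePreserving_last hP n).quasiMeasurePreserving.ae
    (transitionOp_coeFn hP g)] with ω hω
  rw [hω, integral_const_mul, Kernel.comap_apply]

/-- The sum `f(X₁) + ⋯ + f(X_n)`. -/
def pathSum (f : E → ℝ) (n : ℕ) (ω : Fin (n + 1) → E) : ℝ := ∑ i : Fin n, f (ω i.succ)

omit [MeasurableSpace E] in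
theorem pathSum_snoc (f : E → ℝ) (n : ℕ) (p : (Fin (n + 1) → E) × E) :
    pathSum f (n + 1) (Fin.snoc (α := fun _ => E) p.1 p.2) = pathSum f n p.1 + f p.2 := by
  rw [pathSum, Fin.sum_univ_castSucc]
  congr 1
  · refine Finset.sum_congr rfl fun i _ => ?_
    rw [Fin.succ_castSucc, Fin.snoc_castSucc]
  · rw [Fin.succ_last, Fin.snoc_last]

variable {f : E → ℝ}

theorem measurePreserving_coord (hP : P.Invariant μ) (n : ℕ) (i : Fin (n + 1)) :
    MeasurePreserving (fun ω : Fin (n + 1) → E => ω i) (pathLaw μ P n) μ := by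
  induction n with
  | zero =>
    rw [Fin.eq_zero i]
    exact measurePreserving_last hP 0
  | succ n ih =>
    induction i using Fin.lastCases with
    | last => exact measurePreserving_last hP (n + 1)
    | cast i =>
      refine ⟨measurable_pi_apply _, ?_⟩
      rw [← (measurePreserving_snoc n).map_eq,
        Measure.map_map (measurable_pi_apply _) (measurable_snoc _)]
      convert ((ih i).comp (measurePreserving_stepLaw_fst n)).map_eq using 2
      funext p
      simp

theorem memLp_pathSum (hP : P.Invariant μ) (hf : MemLp f 2 μ) (n : ℕ) :
    MemLp (pathSum f n) 2 (pathLaw μ P n) :=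
  memLp_finsetSum _ fun i _ => hf.comp_measurePreserving (measurePreserving_coord hP n i.succ)

theorem integral_pathSum (hP : P.Invariant μ) (hf : MemLp f 2 μ) (n : ℕ) :
    ∫ ω, pathSum f n ω ∂(pathLaw μ P n) = n * ∫ x, f x ∂μ := by
  simp only [pathSum]
  have hi : ∀ i ∈ Finset.univ, Integrable (fun ω : Fin (n + 1) → E => f (ω (Fin.succ i)))
      (pathLaw μ P n) := fun i _ =>
    (hf.comp_measurePreserving (measurePreserving_coord hP n i.succ)).integrable (by norm_num)
  rw [integral_finsetSum _ hi]
  simp [integral_comp_measurePreserving (measurePreserving_coord hP n _) hf.1]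

/-- By the Markov property, replacing `n + 1` by `n` replaces `g` by `T g`, up to the term of
`f(X_{n+1})`. -/
theorem integral_pathSum_mul (hP : P.Invariant μ) (hf : MemLp f 2 μ) (n : ℕ) (g : Lp ℝ 2 μ) :
    ∫ ω, pathSum f n ω * g (ω (Fin.last n)) ∂(pathLaw μ P n) =
      ∑ j ∈ Finset.range n, inner ℝ (hf.toLp f) ((transitionOp hP ^ j) g) := by
  induction n generalizing g with
  | zero => simp [pathSum]
  | succ n ih =>
    have hg := (Lp.memLp g).comp_measurePreserving (measurePreserving_last hP (n + 1))
    have h1 := (memLp_pathSum hP hf n).comp_measurePreserving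
      (measurePreserving_stepLaw_fst (P := P) n)
    have h2 := hf.comp_measurePreserving (measurePreserving_stepLaw_snd hP n)
    have h3 := (Lp.memLp g).comp_measurePreserving (measurePreserving_stepLaw_snd hP n)
    rw [← integral_comp_measurePreserving (measurePreserving_snoc n)
      (f := fun ω => pathSum f (n + 1) ω * g (ω (Fin.last (n + 1))))
      ((memLp_pathSum hP hf (n + 1)).1.mul hg.1)]
    simp only [pathSum_snoc, Fin.snoc_last, add_mul]
    have i1 : Integrable (fun p : (Fin (n + 1) → E) × E => pathSum f n p.1 * g p.2)
      (stepLaw μ P n) := h1.integrable_mul h3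
    have i2 : Integrable (fun p : (Fin (n + 1) → E) × E => f p.2 * g p.2)
      (stepLaw μ P n) := h2.integrable_mul h3
    have e : ∫ p, f p.2 * g p.2 ∂(stepLaw μ P n) = inner ℝ (hf.toLp f) g := by
      have := inner_toLp hf (Lp.memLp g)
      rw [Lp.toLp_coeFn] at this
      rw [this]
      exact integral_comp_measurePreserving (f := fun x => f x * g x)
        (measurePreserving_stepLaw_snd hP n) (hf.1.mul (Lp.memLp g).1)
    rw [integral_add i1 i2, integral_stepLaw_mul hP n (memLp_pathSum hP hf n), ih, e,
      Finset.sum_range_succ']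
    simp [pow_succ]

theorem integral_pathSum_sq (hP : P.Invariant μ) (hf : MemLp f 2 μ) (n : ℕ) :
    ∫ ω, pathSum f n ω ^ 2 ∂(pathLaw μ P n) = sumVariance (transitionOp hP) (hf.toLp f) n := by
  induction n with
  | zero => simp [pathSum, sumVariance]
  | succ n ih =>
    have h1 := (memLp_pathSum hP hf n).comp_measurePreserving
      (measurePreserving_stepLaw_fst (P := P) n)
    have h2 := hf.comp_measurePreserving (measurePreserving_stepLaw_snd hP n)
    rw [← integral_comp_measurePreserving (measurePreserving_snoc n)
      (f := fun ω => pathSum f (n + 1) ω ^ 2) ((memLp_pathSum hP hf (n + 1)).1.pow 2)]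
    simp only [pathSum_snoc, add_sq, mul_assoc]
    have i1 : Integrable (fun p : (Fin (n + 1) → E) × E => pathSum f n p.1 ^ 2)
      (stepLaw μ P n) := h1.integrable_sq
    have i2 : Integrable (fun p : (Fin (n + 1) → E) × E => pathSum f n p.1 * f p.2)
      (stepLaw μ P n) := h1.integrable_mul h2
    have i3 : Integrable (fun p : (Fin (n + 1) → E) × E => f p.2 ^ 2)
      (stepLaw μ P n) := h2.integrable_sq
    have i4 : Integrable (fun p : (Fin (n + 1) → E) × E =>
      pathSum f n p.1 ^ 2 + 2 * (pathSum f n p.1 * f p.2)) (stepLaw μ P n) :=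
      i1.add (i2.const_mul 2)
    have e1 : ∫ p, pathSum f n p.1 ^ 2 ∂(stepLaw μ P n) =
        ∫ ω, pathSum f n ω ^ 2 ∂(pathLaw μ P n) :=
      integral_comp_measurePreserving (f := fun ω => pathSum f n ω ^ 2)
        (measurePreserving_stepLaw_fst n) ((memLp_pathSum hP hf n).1.pow 2)
    have e2 : ∫ p, pathSum f n p.1 * f p.2 ∂(stepLaw μ P n) =
        ∑ j ∈ Finset.range n, inner ℝ (hf.toLp f) ((transitionOp hP ^ (j + 1)) (hf.toLp f)) := by
      have : ∫ p, pathSum f n p.1 * f p.2 ∂(stepLaw μ P n) =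
          ∫ p, pathSum f n p.1 * hf.toLp f p.2 ∂(stepLaw μ P n) := by
        refine integral_congr_ae ?_
        filter_upwards [(measurePreserving_stepLaw_snd hP n).quasiMeasurePreserving.ae
          hf.coeFn_toLp] with p hp
        rw [hp]
      rw [this, integral_stepLaw_mul hP n (memLp_pathSum hP hf n), integral_pathSum_mul hP hf]
      simp [pow_succ]
    have e3 : ∫ p, f p.2 ^ 2 ∂(stepLaw μ P n) = inner ℝ (hf.toLp f) (hf.toLp f) := by
      rw [inner_toLp, integral_comp_measurePreserving (f := fun x => f x ^ 2)
        (measurePreserving_stepLaw_snd hP n) (hf.1.pow 2)]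
      simp [sq]
    rw [integral_add i4 i3, integral_add i1 (i2.const_mul 2), integral_const_mul, e1, e2, e3, ih,
      sumVariance, sumVariance, Finset.sum_range_succ _ n, autocovSum, Finset.sum_range_succ' _ n]
    simp
    ring

/-- The variance of a normalized sum, in terms of the transition operator and the centred
function. -/
theorem scaledVariance_eq (hP : P.Invariant μ) (hf : MemLp f 2 μ)
    (hf₀ : MemLp (fun x => f x - ∫ y, f y ∂μ) 2 μ) (n : ℕ) :
    scaledVariance μ P f n =
      ENNReal.ofReal (sumVariance (transitionOp hP) (hf₀.toLp _) n / n) := by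
  have hm := memLp_pathSum hP hf₀ n
  have e : (fun ω : Fin (n + 1) → E => (√(n : ℝ))⁻¹ * ∑ i : Fin n, f (ω i.succ)) =
      fun ω => (√(n : ℝ))⁻¹ * pathSum (fun x => f x - ∫ y, f y ∂μ) n ω +
        (√(n : ℝ))⁻¹ * (n * ∫ y, f y ∂μ) := by
    funext ω
    simp [pathSum, mul_sub]
  have hm' := hm.const_mul (√(n : ℝ))⁻¹
  have h0 : ∫ ω, pathSum (fun x => f x - ∫ y, f y ∂μ) n ω ∂(pathLaw μ P n) = 0 := by
    rw [integral_pathSum hP hf₀, integral_sub (hf.integrable (by norm_num)) (integrable_const _)]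
    simp
  rw [scaledVariance, e]
  refine (hm'.add (memLp_const _)).ofReal_variance_eq.symm.trans ?_
  congr 1
  refine (variance_add_const hm'.1 _).trans ?_
  rw [variance_const_mul, variance_eq_sub hm, h0, inv_pow, Real.sq_sqrt (by positivity),
    div_eq_inv_mul, ← integral_pathSum_sq hP hf₀]
  simp

/-- For a reversible chain the limit that defines the asymptotic variance exists. -/
theorem asymptoticVarianceExists_of_isReversible (hP : P.IsReversible μ) (hf : MemLp f 2 μ) :
    AsymptoticVarianceExists μ P f := by
  have hf₀ : MemLp (fun x => f x - ∫ y, f y ∂μ) 2 μ := hf.sub (memLp_const _)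
  obtain ⟨c, hc⟩ := exists_tendsto_sumVariance (f := hf₀.toLp _) (transitionOp_symm hP)
    (norm_transitionOp_le hP.invariant)
  simp only [← scaledVariance_eq hP.invariant hf hf₀] at hc
  have : asymptoticVariance μ P f = c := hc.limsup_eq
  rw [AsymptoticVarianceExists, this]
  exact hc

end Path

/-! ### Comparison of reversible kernels through their Dirichlet forms -/

section Comparison

variable {E : Type*} [MeasurableSpace E] {μ : Measure E} {P₁ P₂ : Kernel E E}

theorem rightGap_mono
    (h : ∀ f : E → ℝ, MemLp f 2 μ → dirichletForm μ P₁ f ≤ dirichletForm μ P₂ f) :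
    rightGap μ P₁ ≤ rightGap μ P₂ :=
  iInf₂_mono fun f hf => h f hf.1

variable [IsProbabilityMeasure μ] [IsMarkovKernel P₁] [IsMarkovKernel P₂]

theorem inner_transitionOp_le_of_dirichletForm_le (hP₁ : P₁.Invariant μ) (hP₂ : P₂.Invariant μ)
    {f : E → ℝ} (hf : MemLp f 2 μ) (h : dirichletForm μ P₁ f ≤ dirichletForm μ P₂ f) :
    inner ℝ (hf.toLp f) (transitionOp hP₂ (hf.toLp f)) ≤
      inner ℝ (hf.toLp f) (transitionOp hP₁ (hf.toLp f)) := by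
  rw [dirichletForm_eq hP₁ hf, dirichletForm_eq hP₂ hf, ENNReal.ofReal_le_ofReal_iff
    (sub_nonneg.2 (inner_transitionOp_le hP₂ _))] at h
  linarith

theorem autocovariance_le_of_dirichletForm_le (hP₁ : P₁.Invariant μ) (hP₂ : P₂.Invariant μ)
    {f : E → ℝ} (hf : MemLp f 2 μ) (h : dirichletForm μ P₁ f ≤ dirichletForm μ P₂ f) :
    autocovariance μ P₂ f ≤ autocovariance μ P₁ f := by
  rw [autocovariance_eq hP₁ hf, autocovariance_eq hP₂ hf]
  linarith [inner_transitionOp_le_of_dirichletForm_le hP₁ hP₂ hf h]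

/-- The asymptotic variances of reversible kernels are ordered oppositely to the Dirichlet
forms. -/
theorem asymptoticVariance_le_of_dirichletForm_le (hP₁ : P₁.IsReversible μ)
    (hP₂ : P₂.IsReversible μ)
    (h : ∀ f : E → ℝ, MemLp f 2 μ → dirichletForm μ P₁ f ≤ dirichletForm μ P₂ f)
    {f : E → ℝ} (hf : MemLp f 2 μ) :
    asymptoticVariance μ P₂ f ≤ asymptoticVariance μ P₁ f := by
  have hf₀ : MemLp (fun x => f x - ∫ y, f y ∂μ) 2 μ := hf.sub (memLp_const _)
  have h₁ := asymptoticVarianceExists_of_isReversible hP₁ hf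
  have h₂ := asymptoticVarianceExists_of_isReversible hP₂ hf
  rw [AsymptoticVarianceExists] at h₁ h₂
  refine limit_sumVariance_le (f := hf₀.toLp _) (transitionOp_symm hP₁)
    (norm_transitionOp_le hP₁.invariant) (norm_transitionOp_le hP₂.invariant) (fun F => ?_)
    (h₁.congr (scaledVariance_eq hP₁.invariant hf hf₀))
    (h₂.congr (scaledVariance_eq hP₂.invariant hf hf₀))
  have := inner_transitionOp_le_of_dirichletForm_le hP₁.invariant hP₂.invariant (Lp.memLp F)
    (h F (Lp.memLp F))
  rwa [Lp.toLp_coeFn] at this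

end Comparison

/-! ### Acceptance ratios -/

section Ratio

variable {Z : Type*} [MeasurableSpace Z] {μ μ' : Measure Z}

theorem acceptanceRatio_nonneg (z : Z) : 0 ≤ acceptanceRatio μ μ' z := by
  simp only [acceptanceRatio]
  split_ifs <;> positivity

@[fun_prop]
theorem measurable_acceptanceRatio : Measurable (acceptanceRatio μ μ') := by
  have h₁ : Measurable fun z => (μ.rnDeriv (μ + μ') z).toReal := by fun_prop
  have h₂ : Measurable fun z => (μ'.rnDeriv (μ + μ') z).toReal := by fun_prop
  exact Measurable.ite ((measurableSet_lt measurable_const h₁).inter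
    (measurableSet_lt measurable_const h₂)) (h₂.div h₁) measurable_const

theorem acceptanceRatio_pos_iff {z : Z} : 0 < acceptanceRatio μ μ' z ↔
    0 < (μ.rnDeriv (μ + μ') z).toReal ∧ 0 < (μ'.rnDeriv (μ + μ') z).toReal := by
  simp only [acceptanceRatio]
  split_ifs with h
  · exact ⟨fun _ => h, fun _ => div_pos h.2 h.1⟩
  · exact ⟨fun h' => absurd h' (lt_irrefl _), fun h' => absurd h' h⟩

theorem measurableSet_acceptanceRatio_pos : MeasurableSet {z | 0 < acceptanceRatio μ μ' z} :=
  measurableSet_lt measurable_const measurable_acceptanceRatio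

variable [IsFiniteMeasure μ] [IsFiniteMeasure μ']

/-- The acceptance ratio is a density of `μ'` with respect to `μ` on the set where it is
positive. -/
theorem withDensity_acceptanceRatio :
    μ.withDensity (fun z => ENNReal.ofReal (acceptanceRatio μ μ' z)) =
      μ'.restrict {z | 0 < acceptanceRatio μ μ' z} := by
  have h₁ : μ ≪ μ + μ' := Measure.absolutelyContinuous_of_le (Measure.le_add_right le_rfl)
  have h₂ : μ' ≪ μ + μ' := Measure.absolutelyContinuous_of_le (Measure.le_add_left le_rfl)
  have hS := measurableSet_acceptanceRatio_pos (μ := μ) (μ' := μ')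
  have hR : Measurable fun z => ENNReal.ofReal (acceptanceRatio μ μ' z) := by fun_prop
  calc μ.withDensity (fun z => ENNReal.ofReal (acceptanceRatio μ μ' z))
      = ((μ + μ').withDensity (μ.rnDeriv (μ + μ'))).withDensity
          (fun z => ENNReal.ofReal (acceptanceRatio μ μ' z)) := by
        rw [Measure.withDensity_rnDeriv_eq _ _ h₁]
    _ = (μ + μ').withDensity
          ({z | 0 < acceptanceRatio μ μ' z}.indicator (μ'.rnDeriv (μ + μ'))) := by
        rw [← withDensity_mul _ (Measure.measurable_rnDeriv _ _) hR]
        refine withDensity_congr_ae ?_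
        filter_upwards [Measure.rnDeriv_lt_top μ (μ + μ'), Measure.rnDeriv_lt_top μ' (μ + μ')]
          with z h1 h2
        rw [Pi.mul_apply]
        by_cases hz : 0 < acceptanceRatio μ μ' z
        · rw [Set.indicator_of_mem (show z ∈ {z | 0 < acceptanceRatio μ μ' z} from hz)]
          have hp := acceptanceRatio_pos_iff.1 hz
          nth_rewrite 1 [← ENNReal.ofReal_toReal h1.ne]
          rw [← ENNReal.ofReal_mul hp.1.le, acceptanceRatio, if_pos hp, mul_div_cancel₀ _ hp.1.ne',
            ENNReal.ofReal_toReal h2.ne]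
        · rw [Set.indicator_of_notMem (show z ∉ {z | 0 < acceptanceRatio μ μ' z} from hz),
            ENNReal.ofReal_of_nonpos (not_lt.1 hz), mul_zero]
    _ = μ'.restrict {z | 0 < acceptanceRatio μ μ' z} := by
        rw [withDensity_indicator hS, ← restrict_withDensity hS,
          Measure.withDensity_rnDeriv_eq _ _ h₂]

/-- Among the nonnegative `h` with `h dμ ≤ dμ'`, the acceptance ratio is the largest. -/
theorem ae_le_acceptanceRatio {h : Z → ℝ≥0∞} (hm : Measurable h) (hle : μ.withDensity h ≤ μ') :
    ∀ᵐ z ∂μ, h z ≤ ENNReal.ofReal (acceptanceRatio μ μ' z) := by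
  have h₁ : μ ≪ μ + μ' := Measure.absolutelyContinuous_of_le (Measure.le_add_right le_rfl)
  have h₂ : μ' ≪ μ + μ' := Measure.absolutelyContinuous_of_le (Measure.le_add_left le_rfl)
  have hS := measurableSet_acceptanceRatio_pos (μ := μ) (μ' := μ')
  -- neither density vanishes, up to a null set of the measure `h dμ`
  have hnull : μ.withDensity h {z | 0 < acceptanceRatio μ μ' z}ᶜ = 0 := by
    have e₁ : ∀ᵐ z ∂(μ.withDensity h), 0 < (μ.rnDeriv (μ + μ') z).toReal := by
      refine (withDensity_absolutelyContinuous μ h).ae_le ?_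
      filter_upwards [Measure.rnDeriv_pos h₁, h₁.ae_le (Measure.rnDeriv_lt_top μ (μ + μ'))]
        with z hz hz' using ENNReal.toReal_pos hz.ne' hz'.ne
    have e₂ : ∀ᵐ z ∂(μ.withDensity h), 0 < (μ'.rnDeriv (μ + μ') z).toReal := by
      refine (Measure.absolutelyContinuous_of_le hle).ae_le ?_
      filter_upwards [Measure.rnDeriv_pos h₂, h₂.ae_le (Measure.rnDeriv_lt_top μ' (μ + μ'))]
        with z hz hz' using ENNReal.toReal_pos hz.ne' hz'.ne
    have e : ∀ᵐ z ∂(μ.withDensity h), 0 < acceptanceRatio μ μ' z := by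
      filter_upwards [e₁, e₂] with z h1 h2 using acceptanceRatio_pos_iff.2 ⟨h1, h2⟩
    exact e
  refine ae_le_of_forall_setLIntegral_le_of_sigmaFinite hm fun s hs _ => ?_
  rw [← withDensity_apply _ hs, ← withDensity_apply _ hs, withDensity_acceptanceRatio,
    Measure.restrict_apply hs]
  calc μ.withDensity h s
      ≤ μ.withDensity h (s ∩ {z | 0 < acceptanceRatio μ μ' z}) +
          μ.withDensity h {z | 0 < acceptanceRatio μ μ' z}ᶜ := by
        refine (measure_mono fun z hz => ?_).trans (measure_union_le _ _)
        by_cases h : 0 < acceptanceRatio μ μ' z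
        · exact Or.inl ⟨hz, h⟩
        · exact Or.inr h
    _ ≤ μ' (s ∩ {z | 0 < acceptanceRatio μ μ' z}) := by
        rw [hnull, add_zero]
        exact hle _

/-- The measure with density `min{1, dμ'/dμ}` with respect to `μ` is the infimum of `μ`
and `μ'`. -/
theorem le_withDensity_min_acceptanceRatio {κ : Measure Z} (h₁ : κ ≤ μ) (h₂ : κ ≤ μ') :
    κ ≤ μ.withDensity (fun z => ENNReal.ofReal (min 1 (acceptanceRatio μ μ' z))) := by
  have : IsFiniteMeasure κ := isFiniteMeasure_of_le μ h₁
  have hac : κ ≪ μ := Measure.absolutelyContinuous_of_le h₁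
  have e := Measure.withDensity_rnDeriv_eq κ μ hac
  rw [← e]
  refine withDensity_mono ?_
  filter_upwards [Measure.rnDeriv_le_one_of_le h₁,
    ae_le_acceptanceRatio (Measure.measurable_rnDeriv κ μ) (e.trans_le h₂)] with z h1 h2
  rw [ENNReal.ofReal_min, ENNReal.ofReal_one]
  exact le_min h1 h2

theorem withDensity_min_acceptanceRatio_le :
    μ.withDensity (fun z => ENNReal.ofReal (min 1 (acceptanceRatio μ μ' z))) ≤ μ ∧
    μ.withDensity (fun z => ENNReal.ofReal (min 1 (acceptanceRatio μ μ' z))) ≤ μ' := by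
  constructor
  · refine (withDensity_mono (g := 1) (ae_of_all _ fun z => ?_)).trans_eq (withDensity_one)
    exact ENNReal.ofReal_le_one.2 (min_le_left _ _)
  · calc _ ≤ μ.withDensity (fun z => ENNReal.ofReal (acceptanceRatio μ μ' z)) :=
          withDensity_mono (ae_of_all _ fun z => ENNReal.ofReal_le_ofReal (min_le_right _ _))
      _ ≤ μ' := by
          rw [withDensity_acceptanceRatio]
          exact Measure.restrict_le_self

/-- If an involution exchanges `μ` and `μ'`, it leaves invariant the accepted part of `μ`. -/
theorem map_withDensity_min_acceptanceRatio {e : Z → Z} (he : Measurable e)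
    (hinv : Function.Involutive e) (hμ : μ.map e = μ') :
    (μ.withDensity (fun z => ENNReal.ofReal (min 1 (acceptanceRatio μ μ' z)))).map e =
      μ.withDensity (fun z => ENNReal.ofReal (min 1 (acceptanceRatio μ μ' z))) := by
  set κ := μ.withDensity (fun z => ENNReal.ofReal (min 1 (acceptanceRatio μ μ' z))) with hκ
  have hμ' : μ'.map e = μ := by
    rw [← hμ, Measure.map_map he he, hinv.comp_self, Measure.map_id]
  obtain ⟨h1, h2⟩ := withDensity_min_acceptanceRatio_le (μ := μ) (μ' := μ')
  have key : κ.map e ≤ κ := le_withDensity_min_acceptanceRatio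
    ((Measure.map_mono h2 he).trans_eq hμ') ((Measure.map_mono h1 he).trans_eq hμ)
  refine le_antisymm key ?_
  have := Measure.map_mono key he
  rwa [Measure.map_map he he, hinv.comp_self, Measure.map_id] at this

end Ratio

/-! ### Acceptance-rejection kernels -/

section AcceptReject

variable {X W : Type*} [MeasurableSpace X] [MeasurableSpace W] {Q : Kernel X (X × W)}
  {a : X → X × W → ℝ} {π : Measure X}

/-- The integral of `g(x, y)` with respect to the flow `π(dx) Q(x, d(y, w)) a(x, y, w)` of accepted
moves. -/
noncomputable def acceptedFlow (π : Measure X) (Q : Kernel X (X × W)) (a : X → X × W → ℝ)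
    (g : X × X → ℝ≥0∞) : ℝ≥0∞ :=
  ∫⁻ x, ∫⁻ p, ENNReal.ofReal (a x p) * g (x, p.1) ∂(Q x) ∂π

theorem lintegral_acceptReject [IsMarkovKernel Q] (ha : Measurable (Function.uncurry a))
    {g : X → ℝ≥0∞} (hg : Measurable g) (x : X) :
    ∫⁻ y, g y ∂(acceptReject Q a x) = ∫⁻ p, ENNReal.ofReal (a x p) * g p.1 ∂(Q x) +
      (1 - ∫⁻ p, ENNReal.ofReal (a x p) ∂(Q x)) * g x := by
  have hm : Measurable (Function.uncurry fun x p => ENNReal.ofReal (a x p)) := ha.ennreal_ofReal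
  have hrej : Measurable (Function.uncurry
      fun (x : X) (_ : X) => 1 - ∫⁻ p, ENNReal.ofReal (a x p) ∂(Q x)) :=
    (measurable_const.sub hm.lintegral_kernel_prod_right).comp measurable_fst
  rw [acceptReject, add_apply, lintegral_add_measure, Kernel.lintegral_map _ measurable_fst _ hg,
    Kernel.lintegral_withDensity _ hm _ (g := fun p => g p.1) (hg.comp measurable_fst),
    Kernel.lintegral_withDensity _ hrej _ hg, Kernel.id_apply,
    lintegral_dirac' _ (by fun_prop)]

theorem isMarkovKernel_acceptReject [IsMarkovKernel Q] (ha : Measurable (Function.uncurry a))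
    (ha₁ : ∀ x p, a x p ≤ 1) : IsMarkovKernel (acceptReject Q a) := by
  refine ⟨fun x => ⟨?_⟩⟩
  have h := lintegral_acceptReject (Q := Q) ha (measurable_const (a := (1 : ℝ≥0∞))) x
  rw [lintegral_one] at h
  rw [h]
  simp only [mul_one]
  refine add_tsub_cancel_of_le ?_
  calc _ ≤ ∫⁻ _, 1 ∂(Q x) := lintegral_mono fun p => ENNReal.ofReal_le_one.2 (ha₁ x p)
    _ = 1 := by simp

theorem lintegral_lintegral_acceptReject [IsMarkovKernel Q] (ha : Measurable (Function.uncurry a))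
    {g : X × X → ℝ≥0∞} (hg : Measurable g) :
    ∫⁻ x, ∫⁻ y, g (x, y) ∂(acceptReject Q a x) ∂π = acceptedFlow π Q a g +
      ∫⁻ x, (1 - ∫⁻ p, ENNReal.ofReal (a x p) ∂(Q x)) * g (x, x) ∂π := by
  have hm : Measurable (Function.uncurry fun x p => ENNReal.ofReal (a x p)) := ha.ennreal_ofReal
  rw [acceptedFlow, ← lintegral_add_right]
  · exact lintegral_congr fun x =>
      lintegral_acceptReject ha (hg.comp measurable_prodMk_left) x
  · exact (measurable_const.sub hm.lintegral_kernel_prod_right).mul (hg.comp (by fun_prop))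

theorem isReversible_of_lintegral_symm {P : Kernel X X}
    (h : ∀ g : X × X → ℝ≥0∞, Measurable g →
      ∫⁻ x, ∫⁻ y, g (x, y) ∂(P x) ∂π = ∫⁻ x, ∫⁻ y, g (y, x) ∂(P x) ∂π) : P.IsReversible π := by
  intro A B hA hB
  have key : ∀ {A B : Set X}, MeasurableSet A → MeasurableSet B → ∫⁻ x in A, P x B ∂π =
      ∫⁻ x, ∫⁻ y, A.indicator 1 x * B.indicator 1 y ∂(P x) ∂π := fun {A B} hA hB => by
    rw [← lintegral_indicator hA]
    refine lintegral_congr fun x => ?_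
    rw [lintegral_const_mul _ (measurable_one.indicator hB), lintegral_indicator_one hB]
    by_cases hx : x ∈ A <;> simp [hx]
  rw [key hA hB, key hB hA]
  refine (h (fun p => A.indicator 1 p.1 * B.indicator 1 p.2) ?_).trans ?_
  · exact ((measurable_one.indicator hA).comp measurable_fst).mul
      ((measurable_one.indicator hB).comp measurable_snd)
  · simp only [mul_comm]

theorem isReversible_acceptReject [IsMarkovKernel Q] (ha : Measurable (Function.uncurry a))
    (h : ∀ g : X × X → ℝ≥0∞, Measurable g →
      acceptedFlow π Q a g = acceptedFlow π Q a (fun p => g p.swap)) :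
    (acceptReject Q a).IsReversible π := by
  refine isReversible_of_lintegral_symm fun g hg => ?_
  rw [lintegral_lintegral_acceptReject ha hg, h g hg]
  exact (lintegral_lintegral_acceptReject ha (hg.comp measurable_swap)).symm

theorem dirichletForm_acceptReject [IsMarkovKernel Q] (ha : Measurable (Function.uncurry a))
    {f : X → ℝ} (hf : Measurable f) : dirichletForm π (acceptReject Q a) f =
      2⁻¹ * acceptedFlow π Q a (fun p => ENNReal.ofReal ((f p.1 - f p.2) ^ 2)) := by
  rw [dirichletForm, lintegral_lintegral_acceptReject
    (g := fun p => ENNReal.ofReal ((f p.1 - f p.2) ^ 2)) ha (by fun_prop)]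
  simp

theorem lintegral_lintegral_halfMix {P₁ P₂ : Kernel X X} {g : X × X → ℝ≥0∞} [IsSFiniteKernel P₁]
    [IsSFiniteKernel P₂] (hg : Measurable g) :
    ∫⁻ x, ∫⁻ y, g (x, y) ∂(halfMix P₁ P₂ x) ∂π =
      2⁻¹ * ∫⁻ x, ∫⁻ y, g (x, y) ∂(P₁ x) ∂π + 2⁻¹ * ∫⁻ x, ∫⁻ y, g (x, y) ∂(P₂ x) ∂π := by
  have h₁ : Measurable fun x => ∫⁻ y, g (x, y) ∂(P₁ x) := hg.lintegral_kernel_prod_right'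
  have h₂ : Measurable fun x => ∫⁻ y, g (x, y) ∂(P₂ x) := hg.lintegral_kernel_prod_right'
  rw [← lintegral_const_mul _ h₁, ← lintegral_const_mul _ h₂,
    ← lintegral_add_left (h₁.const_mul _)]
  refine lintegral_congr fun x => ?_
  change ∫⁻ y, g (x, y) ∂((2⁻¹ : ℝ≥0∞) • P₁ x + (2⁻¹ : ℝ≥0∞) • P₂ x) = _
  rw [lintegral_add_measure, lintegral_smul_measure, lintegral_smul_measure, smul_eq_mul,
    smul_eq_mul]

theorem isMarkovKernel_halfMix {P₁ P₂ : Kernel X X} [IsMarkovKernel P₁] [IsMarkovKernel P₂] :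
    IsMarkovKernel (halfMix P₁ P₂) := by
  refine ⟨fun x => ⟨?_⟩⟩
  change ((2⁻¹ : ℝ≥0∞) • P₁ x + (2⁻¹ : ℝ≥0∞) • P₂ x) Set.univ = 1
  simp [ENNReal.inv_two_add_inv_two]

variable {W' : Type*} [MeasurableSpace W'] {Q' : Kernel X (X × W')} {a' : X → X × W' → ℝ}
  [IsMarkovKernel Q] [IsMarkovKernel Q']

/-- The equal mixture of two acceptance-rejection kernels is reversible if each of the two flows of
accepted moves is the reverse of the other one. -/
theorem isReversible_halfMix_acceptReject (ha : Measurable (Function.uncurry a))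
    (ha₁ : ∀ x p, a x p ≤ 1) (ha' : Measurable (Function.uncurry a')) (ha'₁ : ∀ x p, a' x p ≤ 1)
    (h : ∀ g : X × X → ℝ≥0∞, Measurable g →
      acceptedFlow π Q a g = acceptedFlow π Q' a' (fun p => g p.swap)) :
    (halfMix (acceptReject Q a) (acceptReject Q' a')).IsReversible π := by
  have := isMarkovKernel_acceptReject (Q := Q) ha ha₁
  have := isMarkovKernel_acceptReject (Q := Q') ha' ha'₁
  refine isReversible_of_lintegral_symm fun g hg => ?_
  have hg' : Measurable fun p : X × X => g p.swap := hg.comp measurable_swap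
  rw [lintegral_lintegral_halfMix hg, lintegral_lintegral_acceptReject ha hg,
    lintegral_lintegral_acceptReject ha' hg]
  refine Eq.trans ?_ (lintegral_lintegral_halfMix hg').symm
  rw [lintegral_lintegral_acceptReject ha hg', lintegral_lintegral_acceptReject ha' hg',
    h g hg, h _ hg']
  simp only [Prod.swap_swap, Prod.swap_prod_mk, mul_add]
  ring

theorem dirichletForm_halfMix_acceptReject (ha : Measurable (Function.uncurry a))
    (ha₁ : ∀ x p, a x p ≤ 1) (ha' : Measurable (Function.uncurry a')) (ha'₁ : ∀ x p, a' x p ≤ 1)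
    (h : ∀ g : X × X → ℝ≥0∞, Measurable g →
      acceptedFlow π Q a g = acceptedFlow π Q' a' (fun p => g p.swap))
    {f : X → ℝ} (hf : Measurable f) :
    dirichletForm π (halfMix (acceptReject Q a) (acceptReject Q' a')) f =
      2⁻¹ * acceptedFlow π Q a (fun p => ENNReal.ofReal ((f p.1 - f p.2) ^ 2)) := by
  have := isMarkovKernel_acceptReject (Q := Q) ha ha₁
  have := isMarkovKernel_acceptReject (Q := Q') ha' ha'₁
  have hg : Measurable fun p : X × X => ENNReal.ofReal ((f p.1 - f p.2) ^ 2) := by fun_prop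
  have e : (fun p : X × X => ENNReal.ofReal ((f p.swap.1 - f p.swap.2) ^ 2)) =
      fun p => ENNReal.ofReal ((f p.1 - f p.2) ^ 2) := by
    funext p
    rw [← neg_sq, neg_sub]
    rfl
  rw [dirichletForm, lintegral_lintegral_halfMix hg, lintegral_lintegral_acceptReject ha hg,
    lintegral_lintegral_acceptReject ha' hg, h _ hg, e]
  simp [← add_mul, ENNReal.inv_two_add_inv_two]

end AcceptReject

/-! ### Metropolis-Hastings -/

section MetropolisHastings

variable {X : Type*} [MeasurableSpace X] {π : Measure X} {q : Kernel X X} [IsMarkovKernel q]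

omit [IsMarkovKernel q] in
theorem measurable_mhRatio : Measurable fun p : X × X => mhRatio π q p.1 p.2 :=
  measurable_acceptanceRatio

omit [IsMarkovKernel q] in
theorem measurable_mhAccept :
    Measurable (Function.uncurry fun (x : X) (p : X × Unit) => min 1 (mhRatio π q x p.1)) :=
  measurable_const.min (measurable_mhRatio.comp
    (measurable_fst.prodMk (measurable_fst.comp measurable_snd)))

instance isMarkovKernel_mhProposal : IsMarkovKernel (q.map fun y => (y, ())) :=
  Kernel.IsMarkovKernel.map q (by fun_prop)

instance isMarkovKernel_mhKernel : IsMarkovKernel (mhKernel π q) :=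
  isMarkovKernel_acceptReject measurable_mhAccept fun _ _ => min_le_left _ _

theorem acceptedFlow_mh [SFinite π] {g : X × X → ℝ≥0∞} (hg : Measurable g) :
    acceptedFlow π (q.map fun y => (y, ())) (fun x p => min 1 (mhRatio π q x p.1)) g =
      ∫⁻ p, ENNReal.ofReal (min 1 (mhRatio π q p.1 p.2)) * g p ∂(π ⊗ₘ q) := by
  have hm : Measurable fun p : X × X => ENNReal.ofReal (min 1 (mhRatio π q p.1 p.2)) :=
    (measurable_const.min measurable_mhRatio).ennreal_ofReal
  refine Eq.trans ?_ (Measure.lintegral_compProd (hm.mul hg)).symm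
  refine lintegral_congr fun x => ?_
  refine Kernel.lintegral_map _ (by fun_prop) _ ?_
  exact (((hm.comp measurable_prodMk_left).comp measurable_fst).mul
    ((hg.comp measurable_prodMk_left).comp measurable_fst))

theorem isReversible_mhKernel [IsFiniteMeasure π] : (mhKernel π q).IsReversible π := by
  refine isReversible_acceptReject measurable_mhAccept fun g hg => ?_
  have hm : Measurable fun p : X × X => ENNReal.ofReal (min 1 (mhRatio π q p.1 p.2)) :=
    (measurable_const.min measurable_mhRatio).ennreal_ofReal
  have hg' : Measurable fun p : X × X => g p.swap := hg.comp measurable_swap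
  have key := map_withDensity_min_acceptanceRatio (μ := π ⊗ₘ q) measurable_swap
    Prod.swap_swap rfl
  have h := lintegral_map (μ := (π ⊗ₘ q).withDensity
    (fun p => ENNReal.ofReal (min 1 (mhRatio π q p.1 p.2)))) hg measurable_swap
  change Measure.map Prod.swap ((π ⊗ₘ q).withDensity
    (fun p => ENNReal.ofReal (min 1 (mhRatio π q p.1 p.2)))) = _ at key
  rw [key] at h
  rw [acceptedFlow_mh hg, acceptedFlow_mh hg']
  refine (lintegral_withDensity_eq_lintegral_mul _ hm hg).symm.trans (h.trans ?_)
  exact lintegral_withDensity_eq_lintegral_mul _ hm hg'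

end MetropolisHastings

/-! ### The averaged-ratio kernels -/

section Averaged

variable {X U : Type*} [MeasurableSpace X] [MeasurableSpace U]

theorem measurable_eval_index {N : ℕ} : Measurable fun p : (Fin N → U) × Fin N => p.1 p.2 :=
  measurable_from_prod_countable_left fun k => measurable_pi_apply k

theorem measurable_glue {N : ℕ} (k : Fin N) :
    Measurable fun p : U × ({i : Fin N // i ≠ k} → U) => glue k p.1 p.2 := by
  refine measurable_pi_iff.2 fun i => ?_
  unfold glue
  split_ifs with h
  · exact measurable_fst
  · exact (measurable_pi_apply _).comp measurable_snd

omit [MeasurableSpace U] in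
@[simp]
theorem glue_self {N : ℕ} (k : Fin N) (u : U) (v : {i : Fin N // i ≠ k} → U) :
    glue k u v k = u := by
  simp [glue]

omit [MeasurableSpace U] in
theorem glue_restrict {N : ℕ} (k : Fin N) (𝔲 : Fin N → U) :
    glue k (𝔲 k) (fun i : {i : Fin N // i ≠ k} => 𝔲 i) = 𝔲 := by
  funext i
  by_cases h : i = k
  · subst h; simp
  · simp [glue, h]

theorem JointLaw.lintegral_joint {Q : Kernel (X × X) U} [IsMarkovKernel Q] {N : ℕ}
    (J : JointLaw Q N) (k : Fin N) (p : X × X) {G : (Fin N → U) → ℝ≥0∞} (hG : Measurable G) :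
    ∫⁻ 𝔲, G 𝔲 ∂(J.joint p) = ∫⁻ u, ∫⁻ v, G (glue k u v) ∂(J.cond k (p, u)) ∂(Q p) := by
  have hm : Measurable fun 𝔲 : Fin N → U => (𝔲 k, fun i : {i : Fin N // i ≠ k} => 𝔲 i) := by
    fun_prop
  have hG' := hG.comp (measurable_glue (U := U) k)
  have h := lintegral_map (μ := J.joint p) hG' hm
  rw [J.disintegrate, Measure.lintegral_compProd hG'] at h
  simp only [Function.comp_apply, glue_restrict] at h
  exact h.symm

theorem JointLaw.lintegral_eval {Q : Kernel (X × X) U} {N : ℕ} (J : JointLaw Q N) (k : Fin N)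
    (p : X × X) {G : U → ℝ≥0∞} (hG : Measurable G) :
    ∫⁻ 𝔲, G (𝔲 k) ∂(J.joint p) = ∫⁻ u, G u ∂(Q p) := by
  rw [← J.map_eval p k, lintegral_map hG (measurable_pi_apply k)]

variable {π : Measure X} {q : Kernel X X} {Q : Kernel (X × X) U}
  {φ : U → U} {N : ℕ}

theorem pmrRatio_nonneg (u : U) (x y : X) : 0 ≤ pmrRatio π q Q φ u x y :=
  acceptanceRatio_nonneg _

theorem avgRatio_nonneg (𝔲 : Fin N → U) (x y : X) : 0 ≤ avgRatio π q Q φ 𝔲 x y :=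
  div_nonneg (Finset.sum_nonneg fun _ _ => pmrRatio_nonneg _ _ _) (Nat.cast_nonneg _)

theorem measurable_pmrRatio : Measurable fun p : X × X × U => pmrRatio π q Q φ p.2.2 p.1 p.2.1 :=
  measurable_acceptanceRatio

theorem measurable_sum_pmrRatio : Measurable fun p : X × X × (Fin N → U) =>
    ∑ i, pmrRatio π q Q φ (p.2.2 i) p.1 p.2.1 :=
  Finset.measurable_sum _ fun i _ => measurable_pmrRatio.comp
    (f := fun p : X × X × (Fin N → U) => (p.1, p.2.1, p.2.2 i)) (by fun_prop)

theorem measurable_avgRatio : Measurable fun p : X × X × (Fin N → U) =>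
    avgRatio π q Q φ p.2.2 p.1 p.2.1 :=
  measurable_sum_pmrRatio.div_const _

theorem measurable_indexWeight : Measurable fun p : X × X × (Fin N → U) × Fin N =>
    indexWeight π q Q φ p.1 p.2.1 p.2.2.1 p.2.2.2 := by
  have h₁ : Measurable fun p : X × X × (Fin N → U) × Fin N =>
      ∑ i, pmrRatio π q Q φ (p.2.2.1 i) p.1 p.2.1 :=
    measurable_sum_pmrRatio.comp (f := fun p : X × X × (Fin N → U) × Fin N =>
      (p.1, p.2.1, p.2.2.1)) (by fun_prop)
  have h₂ : Measurable fun p : X × X × (Fin N → U) × Fin N =>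
      pmrRatio π q Q φ (p.2.2.1 p.2.2.2) p.1 p.2.1 :=
    measurable_pmrRatio.comp (f := fun p : X × X × (Fin N → U) × Fin N =>
      (p.1, p.2.1, p.2.2.1 p.2.2.2)) (measurable_fst.prodMk
        ((measurable_fst.comp measurable_snd).prodMk
          (measurable_eval_index.comp (measurable_snd.comp measurable_snd))))
  exact Measurable.ite (h₁ (measurableSet_singleton 0)) measurable_const (h₂.div h₁)

theorem indexWeight_nonneg (x y : X) (𝔲 : Fin N → U) (k : Fin N) :
    0 ≤ indexWeight π q Q φ x y 𝔲 k := by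
  unfold indexWeight
  split_ifs
  · positivity
  · exact div_nonneg (pmrRatio_nonneg _ _ _) (Finset.sum_nonneg fun _ _ => pmrRatio_nonneg _ _ _)

theorem sum_indexWeight (hN : 1 ≤ N) (x y : X) (𝔲 : Fin N → U) :
    ∑ k, indexWeight π q Q φ x y 𝔲 k = 1 := by
  unfold indexWeight
  split_ifs with h
  · have : (N : ℝ) ≠ 0 := by positivity
    simp [this]
  · rw [← Finset.sum_div, div_self h]

theorem measurable_acceptProb₁ :
    Measurable (Function.uncurry (acceptProb₁ π q Q φ (N := N))) :=
  measurable_const.min (measurable_avgRatio.comp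
    (f := fun p : X × X × (Fin N → U) × Fin N => (p.1, p.2.1, p.2.2.1)) (by fun_prop))

theorem measurable_acceptProb₂ :
    Measurable (Function.uncurry (acceptProb₂ π q Q φ (N := N))) := by
  have h₁ : Measurable fun p : X × X × (Fin N → U) × Fin N =>
      pmrRatio π q Q φ (p.2.2.1 p.2.2.2) p.2.1 p.1 :=
    measurable_pmrRatio.comp (f := fun p : X × X × (Fin N → U) × Fin N =>
      (p.2.1, p.1, p.2.2.1 p.2.2.2)) ((measurable_fst.comp measurable_snd).prodMk
        (measurable_fst.prodMk
          (measurable_eval_index.comp (measurable_snd.comp measurable_snd))))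
  have h₂ : Measurable fun p : X × X × (Fin N → U) × Fin N =>
      avgRatio π q Q φ p.2.2.1 p.2.1 p.1 :=
    measurable_avgRatio.comp
      (f := fun p : X × X × (Fin N → U) × Fin N => (p.2.1, p.1, p.2.2.1)) (by fun_prop)
  exact Measurable.ite (measurableSet_lt measurable_const h₁)
    (measurable_const.min (h₂.const_div 1)) measurable_const

theorem acceptProb₁_le_one (x : X) (p : X × (Fin N → U) × Fin N) :
    acceptProb₁ π q Q φ x p ≤ 1 := min_le_left _ _

theorem acceptProb₂_le_one (x : X) (p : X × (Fin N → U) × Fin N) :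
    acceptProb₂ π q Q φ x p ≤ 1 := by
  unfold acceptProb₂
  split_ifs
  · exact min_le_left _ _
  · exact zero_le_one

/-- The identity between densities behind the reversibility of the averaged-ratio kernel: a move of
the first kind is accepted with the same density as the reverse move of the second kind. -/
theorem indexWeight_mul_acceptProb₁ (hN : 1 ≤ N) (x y : X) (𝔲 : Fin N → U) (k : Fin N) :
    indexWeight π q Q φ x y 𝔲 k * acceptProb₁ π q Q φ x (y, 𝔲, k) =
      (N : ℝ)⁻¹ * (pmrRatio π q Q φ (𝔲 k) x y * acceptProb₂ π q Q φ y (x, 𝔲, k)) := by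
  have hN' : (0 : ℝ) < N := by exact_mod_cast hN
  have hr := pmrRatio_nonneg (π := π) (q := q) (Q := Q) (φ := φ) (𝔲 k) x y
  have hle : pmrRatio π q Q φ (𝔲 k) x y ≤ ∑ i, pmrRatio π q Q φ (𝔲 i) x y :=
    Finset.single_le_sum (f := fun i => pmrRatio π q Q φ (𝔲 i) x y)
      (fun i _ => pmrRatio_nonneg _ _ _) (Finset.mem_univ k)
  simp only [indexWeight, acceptProb₁, acceptProb₂, avgRatio]
  set S := ∑ i, pmrRatio π q Q φ (𝔲 i) x y
  set r := pmrRatio π q Q φ (𝔲 k) x y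
  rcases hr.eq_or_lt with h0 | h0
  · rw [← h0]
    by_cases hS : S = 0 <;> simp [hS]
  · have hS : 0 < S := h0.trans_le hle
    rw [if_neg hS.ne', if_pos h0]
    rcases le_total 1 (S / N) with h | h
    · rw [min_eq_left h, min_eq_right (by rw [one_div]; exact inv_le_one_of_one_le₀ h)]
      field_simp
    · rw [min_eq_right h, min_eq_left (by rw [one_div]; exact (one_le_inv₀ (by positivity)).2 h)]
      field_simp

variable [IsMarkovKernel q] [IsMarkovKernel Q] (J : JointLaw Q N)

omit [IsMarkovKernel Q] in
theorem lintegral_proposal₁ {G : X × (Fin N → U) × Fin N → ℝ≥0∞} (hG : Measurable G) (x : X) :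
    ∫⁻ p, G p ∂(proposal₁ π q Q φ J x) = ∫⁻ y, ∫⁻ 𝔲, ∑ k,
      ENNReal.ofReal (indexWeight π q Q φ x y 𝔲 k) * G (y, 𝔲, k) ∂(J.joint (x, y)) ∂(q x) := by
  have hw : Measurable (Function.uncurry fun (p : (X × X) × (Fin N → U)) (k : Fin N) =>
      ENNReal.ofReal (indexWeight π q Q φ p.1.1 p.1.2 p.2 k)) :=
    (measurable_indexWeight.comp (f := fun p : ((X × X) × (Fin N → U)) × Fin N =>
      (p.1.1.1, p.1.1.2, p.1.2, p.2)) (by fun_prop)).ennreal_ofReal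
  have := Kernel.IsSFiniteKernel.withDensity
    (Kernel.const ((X × X) × (Fin N → U)) (Measure.count : Measure (Fin N)))
    (f := fun p k => ENNReal.ofReal (indexWeight π q Q φ p.1.1 p.1.2 p.2 k))
    (fun _ _ => ENNReal.ofReal_ne_top)
  rw [proposal₁, Kernel.lintegral_compProd _ _ _ hG]
  refine lintegral_congr fun y => ?_
  refine (Kernel.lintegral_compProd _ _ _ (hG.comp measurable_prodMk_left)).trans ?_
  refine lintegral_congr fun 𝔲 => ?_
  refine (Kernel.lintegral_withDensity _ hw _
    ((hG.comp measurable_prodMk_left).comp measurable_prodMk_left)).trans ?_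
  rw [Kernel.const_apply, lintegral_count, tsum_fintype]
  rfl

theorem lintegral_proposal₂ (hφ : Measurable φ) {G : X × (Fin N → U) × Fin N → ℝ≥0∞}
    (hG : Measurable G) (x : X) :
    ∫⁻ p, G p ∂(proposal₂ q Q φ J x) = ∫⁻ y, ∑ k, (N : ℝ≥0∞)⁻¹ *
      ∫⁻ u, ∫⁻ v, G (y, glue k u v, k) ∂(J.cond k ((y, x), u)) ∂(Q.map φ (x, y)) ∂(q x) := by
  have hφQ : IsMarkovKernel (Q.map φ) := Kernel.IsMarkovKernel.map Q hφ
  have hk : ∀ k : Fin N, Measurable fun p : U × ({i : Fin N // i ≠ k} → U) =>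
      (glue k p.1 p.2, k) := fun k => (measurable_glue k).prodMk measurable_const
  have hN : ∀ _ : Fin N, (N : ℝ≥0∞)⁻¹ ≠ ∞ := fun k =>
    ENNReal.inv_ne_top.2 (by exact_mod_cast k.pos.ne')
  have : IsSFiniteKernel (∑ k : Fin N,
    (((Q.map φ) ⊗ₖ (J.cond k).comap (fun p : (X × X) × U => (p.1.swap, p.2))
        ((measurable_swap.comp measurable_fst).prodMk measurable_snd)).map
          (fun p => (glue k p.1 p.2, k))).withDensity (fun _ _ => (N : ℝ≥0∞)⁻¹)) :=
    Kernel.IsSFiniteKernel.finsetSum _ fun k _ =>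
      Kernel.IsSFiniteKernel.withDensity _ fun _ _ => hN k
  rw [proposal₂, Kernel.lintegral_compProd _ _ _ hG]
  refine lintegral_congr fun y => ?_
  have hGy := hG.comp (measurable_prodMk_left (x := y))
  rw [sum_apply, lintegral_finsetSum_measure]
  refine Finset.sum_congr rfl fun k _ => ?_
  refine (Kernel.lintegral_withDensity _ measurable_const _ hGy).trans ?_
  rw [lintegral_const_mul _ hGy, Kernel.lintegral_map _ (hk k) _ hGy]
  congr 1
  exact Kernel.lintegral_compProd _ _ _ (hGy.comp (hk k))

omit [IsMarkovKernel Q] in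
theorem isMarkovKernel_proposal₁ (hN : 1 ≤ N) : IsMarkovKernel (proposal₁ π q Q φ J) := by
  refine ⟨fun x => ⟨?_⟩⟩
  rw [← lintegral_one, lintegral_proposal₁ J measurable_const]
  have : ∀ (y : X) (𝔲 : Fin N → U),
      ∑ k, ENNReal.ofReal (indexWeight π q Q φ x y 𝔲 k) * 1 = 1 := fun y 𝔲 => by
    simp only [mul_one]
    rw [← ENNReal.ofReal_sum_of_nonneg fun k _ => indexWeight_nonneg x y 𝔲 k,
      sum_indexWeight hN, ENNReal.ofReal_one]
  simp only [this]
  simp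

theorem isMarkovKernel_proposal₂ (hN : 1 ≤ N) (hφ : Measurable φ) :
    IsMarkovKernel (proposal₂ q Q φ J) := by
  refine ⟨fun x => ⟨?_⟩⟩
  have hφQ : IsMarkovKernel (Q.map φ) := Kernel.IsMarkovKernel.map Q hφ
  have hN' : (N : ℝ≥0∞) ≠ 0 := by exact_mod_cast (by omega : N ≠ 0)
  rw [← lintegral_one, lintegral_proposal₂ J hφ measurable_const]
  simp [ENNReal.mul_inv_cancel hN' (ENNReal.natCast_ne_top N)]

/-- The mean acceptance probability `∫ Q^N_{x,y}(d𝔲) min{1, r̊^N_𝔲(x, y)}`. -/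
noncomputable def meanAccept (π : Measure X) (q : Kernel X X) [IsMarkovKernel q]
    (Q : Kernel (X × X) U) [IsMarkovKernel Q] (φ : U → U) (J : JointLaw Q N) (p : X × X) : ℝ≥0∞ :=
  ∫⁻ 𝔲, ENNReal.ofReal (min 1 (avgRatio π q Q φ 𝔲 p.1 p.2)) ∂(J.joint p)

theorem acceptedFlow_proposal₁ (hN : 1 ≤ N) {g : X × X → ℝ≥0∞} (hg : Measurable g) :
    acceptedFlow π (proposal₁ π q Q φ J) (acceptProb₁ π q Q φ) g =
      ∫⁻ x, ∫⁻ y, meanAccept π q Q φ J (x, y) * g (x, y) ∂(q x) ∂π := by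
  refine lintegral_congr fun x => ?_
  rw [lintegral_proposal₁ J]
  swap
  · exact (measurable_acceptProb₁.comp measurable_prodMk_left).ennreal_ofReal.mul
      (hg.comp (measurable_prodMk_left.comp measurable_fst))
  refine lintegral_congr fun y => ?_
  have hm : Measurable fun 𝔲 : Fin N → U =>
      ENNReal.ofReal (min 1 (avgRatio π q Q φ 𝔲 x y)) :=
    (measurable_const.min (measurable_avgRatio.comp
      (f := fun 𝔲 : Fin N → U => (x, y, 𝔲)) (by fun_prop))).ennreal_ofReal
  rw [meanAccept, ← lintegral_mul_const _ hm]
  refine lintegral_congr fun 𝔲 => ?_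
  simp only [acceptProb₁]
  rw [← Finset.sum_mul, ← ENNReal.ofReal_sum_of_nonneg fun k _ => indexWeight_nonneg x y 𝔲 k,
      sum_indexWeight hN, ENNReal.ofReal_one, one_mul]

/-- The flow of accepted moves of the first kind is the reverse of that of the second kind. -/
theorem acceptedFlow_proposal₁_eq [IsFiniteMeasure π] (hN : 1 ≤ N) (hφ : Measurable φ)
    {g : X × X → ℝ≥0∞} (hg : Measurable g) :
    acceptedFlow π (proposal₁ π q Q φ J) (acceptProb₁ π q Q φ) g =
      acceptedFlow π (proposal₂ q Q φ J) (acceptProb₂ π q Q φ) (fun p => g p.swap) := by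
  have hφQ : IsMarkovKernel (Q.map φ) := Kernel.IsMarkovKernel.map Q hφ
  -- the conditional mean acceptance probability of the reverse move, given `u⁽ᵏ⁾ = u`
  set H : Fin N → X × X × U → ℝ≥0∞ := fun k z => ∫⁻ v,
    ENNReal.ofReal (acceptProb₂ π q Q φ z.2.1 (z.1, glue k z.2.2 v, k)) * g (z.1, z.2.1)
      ∂(J.cond k ((z.1, z.2.1), z.2.2)) with hH
  have hHm : ∀ k, Measurable (H k) := fun k => by
    have h₁ : Measurable fun p : (X × X × U) × ({i : Fin N // i ≠ k} → U) =>
        acceptProb₂ π q Q φ p.1.2.1 (p.1.1, glue k p.1.2.2 p.2, k) := by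
      have hgl := (measurable_glue (U := U) k).comp
        (by fun_prop : Measurable fun p : (X × X × U) × ({i : Fin N // i ≠ k} → U) =>
          (p.1.2.2, p.2))
      exact measurable_acceptProb₂.comp ((by fun_prop :
        Measurable fun p : (X × X × U) × ({i : Fin N // i ≠ k} → U) => p.1.2.1).prodMk
          (measurable_fst.fst.prodMk (hgl.prodMk measurable_const)))
    have h₂ : Measurable fun p : (X × X × U) × ({i : Fin N // i ≠ k} → U) =>
        g (p.1.1, p.1.2.1) := hg.comp (by fun_prop)
    exact (h₁.ennreal_ofReal.mul h₂).lintegral_kernel_prod_right'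
      (κ := (J.cond k).comap (fun z : X × X × U => ((z.1, z.2.1), z.2.2)) (by fun_prop))
  have hR : Measurable fun z : X × X × U => ENNReal.ofReal (pmrRatio π q Q φ z.2.2 z.1 z.2.1) :=
    measurable_pmrRatio.ennreal_ofReal
  have hS : Measurable fun z => ∑ k, (N : ℝ≥0∞)⁻¹ * H k z :=
    Finset.measurable_sum _ fun k _ => (hHm k).const_mul _
  set e : X × X × U → X × X × U := fun p => (p.2.1, p.1, p.2.2) with he
  have hem : Measurable e := by fun_prop
  have e₁ : acceptedFlow π (proposal₁ π q Q φ J) (acceptProb₁ π q Q φ) g =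
      ∫⁻ z, ENNReal.ofReal (pmrRatio π q Q φ z.2.2 z.1 z.2.1) * ∑ k, (N : ℝ≥0∞)⁻¹ * H k z
        ∂(π ⊗ₘ (q ⊗ₖ Q)) := by
    refine Eq.trans ?_ (Measure.lintegral_compProd (hR.mul hS)).symm
    refine lintegral_congr fun x => ?_
    refine Eq.trans ?_ (Kernel.lintegral_compProd _ _ _
      ((hR.mul hS).comp measurable_prodMk_left)).symm
    rw [lintegral_proposal₁ J]
    swap
    · exact (measurable_acceptProb₁.comp measurable_prodMk_left).ennreal_ofReal.mul
        (hg.comp (measurable_prodMk_left.comp measurable_fst))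
    refine lintegral_congr fun y => ?_
    have hRu : Measurable fun u => ENNReal.ofReal (pmrRatio π q Q φ u x y) :=
      hR.comp (by fun_prop : Measurable fun u : U => (x, y, u))
    have hHu : ∀ k, Measurable fun u => H k (x, y, u) := fun k => (hHm k).comp (by fun_prop)
    have ha : ∀ k : Fin N, Measurable fun 𝔲 : Fin N → U =>
        ENNReal.ofReal (acceptProb₂ π q Q φ y (x, 𝔲, k)) := fun k =>
      (measurable_acceptProb₂.comp (by fun_prop :
        Measurable fun 𝔲 : Fin N → U => (y, (x, 𝔲, k)))).ennreal_ofReal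
    have hG : ∀ k : Fin N, Measurable fun 𝔲 : Fin N → U => (N : ℝ≥0∞)⁻¹ *
        (ENNReal.ofReal (pmrRatio π q Q φ (𝔲 k) x y) *
          (ENNReal.ofReal (acceptProb₂ π q Q φ y (x, 𝔲, k)) * g (x, y))) := fun k =>
      ((hRu.comp (measurable_pi_apply k)).mul ((ha k).mul_const _)).const_mul _
    have hsplit : ∀ (𝔲 : Fin N → U) (k : Fin N),
        ENNReal.ofReal (indexWeight π q Q φ x y 𝔲 k) *
          (ENNReal.ofReal (acceptProb₁ π q Q φ x (y, 𝔲, k)) * g (x, y)) =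
        (N : ℝ≥0∞)⁻¹ * (ENNReal.ofReal (pmrRatio π q Q φ (𝔲 k) x y) *
          (ENNReal.ofReal (acceptProb₂ π q Q φ y (x, 𝔲, k)) * g (x, y))) := fun 𝔲 k => by
      rw [← mul_assoc, ← ENNReal.ofReal_mul (indexWeight_nonneg _ _ _ _),
        indexWeight_mul_acceptProb₁ hN, ENNReal.ofReal_mul (by positivity),
        ENNReal.ofReal_mul (pmrRatio_nonneg _ _ _),
        ENNReal.ofReal_inv_of_pos (by exact_mod_cast hN), ENNReal.ofReal_natCast, mul_assoc,
        mul_assoc]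
    simp only [hsplit, Function.comp_apply, Pi.mul_apply, Finset.mul_sum]
    rw [lintegral_finsetSum _ fun k _ => hG k]
    refine Eq.trans ?_ (lintegral_finsetSum _ fun k _ => hRu.mul ((hHu k).const_mul _)).symm
    refine Finset.sum_congr rfl fun k _ => ?_
    rw [J.lintegral_joint k (x, y) (hG k)]
    refine lintegral_congr fun u => ?_
    have hv : Measurable fun v : {i : Fin N // i ≠ k} → U =>
        ENNReal.ofReal (acceptProb₂ π q Q φ y (x, glue k u v, k)) * g (x, y) :=
      ((ha k).comp ((measurable_glue k).comp measurable_prodMk_left)).mul_const _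
    simp only [glue_self]
    rw [lintegral_const_mul _ (hv.const_mul _), lintegral_const_mul _ hv]
    exact mul_left_comm _ _ _
  have e₂ : acceptedFlow π (proposal₂ q Q φ J) (acceptProb₂ π q Q φ) (fun p => g p.swap) =
      ∫⁻ z, ∑ k, (N : ℝ≥0∞)⁻¹ * H k z ∂((π ⊗ₘ (q ⊗ₖ (Q.map φ))).map e) := by
    rw [lintegral_map hS hem]
    refine Eq.trans ?_ (Measure.lintegral_compProd (hS.comp hem)).symm
    refine lintegral_congr fun x => ?_
    refine Eq.trans ?_ (Kernel.lintegral_compProd _ _ _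
      ((hS.comp hem).comp measurable_prodMk_left)).symm
    rw [lintegral_proposal₂ J hφ]
    swap
    · exact (measurable_acceptProb₂.comp measurable_prodMk_left).ennreal_ofReal.mul
        (hg.comp (by fun_prop : Measurable fun p : X × (Fin N → U) × Fin N => (p.1, x)))
    refine lintegral_congr fun y => ?_
    have hHk : ∀ k, Measurable fun u => H k (y, x, u) := fun k =>
      (hHm k).comp (by fun_prop)
    simp only [Function.comp_apply, he]
    rw [lintegral_finsetSum _ fun k _ => (hHk k).const_mul _]
    refine Finset.sum_congr rfl fun k _ => ?_
    rw [lintegral_const_mul _ (hHk k)]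
    rfl
  rw [e₁, e₂]
  have hd := withDensity_acceptanceRatio (μ := π ⊗ₘ (q ⊗ₖ Q))
    (μ' := (π ⊗ₘ (q ⊗ₖ (Q.map φ))).map e)
  refine (lintegral_withDensity_eq_lintegral_mul _ hR hS).symm.trans ?_
  refine (congrArg (fun m => ∫⁻ z, ∑ k, (N : ℝ≥0∞)⁻¹ * H k z ∂m) hd).trans ?_
  rw [← lintegral_indicator measurableSet_acceptanceRatio_pos]
  refine lintegral_congr fun z => ?_
  by_cases hz : 0 < pmrRatio π q Q φ z.2.2 z.1 z.2.1
  · exact Set.indicator_of_mem (show z ∈ {z | 0 < acceptanceRatio _ _ z} from hz) _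
  · rw [Set.indicator_of_notMem (show z ∉ {z | 0 < acceptanceRatio _ _ z} from hz)]
    simp [hH, acceptProb₂, hz]

end Averaged
/-! ### Dirichlet forms of averaged-ratio kernels -/

section AveragedKernel

variable {X U : Type*} [MeasurableSpace X] [MeasurableSpace U] {π : Measure X} {q : Kernel X X}
  [IsMarkovKernel q] {Q : Kernel (X × X) U} [IsMarkovKernel Q] {φ : U → U} {N : ℕ}
  (J : JointLaw Q N)

theorem isMarkovKernel_avgKernel (hN : 1 ≤ N) (hφ : Measurable φ) :
    IsMarkovKernel (avgKernel π q Q φ J) := by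
  have := isMarkovKernel_proposal₁ (π := π) (q := q) (φ := φ) J hN
  have := isMarkovKernel_proposal₂ (q := q) J hN hφ
  have := isMarkovKernel_acceptReject (Q := proposal₁ π q Q φ J) measurable_acceptProb₁
    (acceptProb₁_le_one (π := π) (q := q) (Q := Q) (φ := φ))
  have := isMarkovKernel_acceptReject (Q := proposal₂ q Q φ J) measurable_acceptProb₂
    (acceptProb₂_le_one (π := π) (q := q) (Q := Q) (φ := φ))
  exact isMarkovKernel_halfMix

theorem isReversible_avgKernel [IsFiniteMeasure π] (hN : 1 ≤ N) (hφ : Measurable φ) :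
    (avgKernel π q Q φ J).IsReversible π := by
  have := isMarkovKernel_proposal₁ (π := π) (q := q) (φ := φ) J hN
  have := isMarkovKernel_proposal₂ (q := q) J hN hφ
  exact isReversible_halfMix_acceptReject measurable_acceptProb₁ acceptProb₁_le_one
    measurable_acceptProb₂ acceptProb₂_le_one fun g hg => acceptedFlow_proposal₁_eq J hN hφ hg

/-- The Dirichlet form of the averaged-ratio kernel depends only on the mean acceptance probability
of the first kind of move. -/
theorem dirichletForm_avgKernel [IsFiniteMeasure π] (hN : 1 ≤ N) (hφ : Measurable φ) {f : X → ℝ}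
    (hf : Measurable f) : dirichletForm π (avgKernel π q Q φ J) f =
      2⁻¹ * ∫⁻ x, ∫⁻ y, meanAccept π q Q φ J (x, y) *
        ENNReal.ofReal ((f x - f y) ^ 2) ∂(q x) ∂π := by
  have := isMarkovKernel_proposal₁ (π := π) (q := q) (φ := φ) J hN
  have := isMarkovKernel_proposal₂ (q := q) J hN hφ
  rw [avgKernel, dirichletForm_halfMix_acceptReject measurable_acceptProb₁ acceptProb₁_le_one
    measurable_acceptProb₂ acceptProb₂_le_one
    (fun g hg => acceptedFlow_proposal₁_eq J hN hφ hg) hf,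
    acceptedFlow_proposal₁ J hN (by fun_prop)]

omit [IsMarkovKernel q] [IsMarkovKernel Q] in
theorem measurable_pmrRatio_left (x y : X) :
    Measurable fun u => ENNReal.ofReal (pmrRatio π q Q φ u x y) :=
  (measurable_pmrRatio.comp (f := fun u : U => (x, y, u)) (by fun_prop)).ennreal_ofReal

/-- The mean over `Q_{x,y}` of the ratio `r̊_u(x, y)` is at most `r(x, y)`: it is the density of a
marginal of a measure that is dominated by `π(dy) q(y, dx) Q̄_{y,x}(du)`. -/
theorem ae_lintegral_pmrRatio_le [IsFiniteMeasure π] (hφ : Measurable φ) :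
    ∀ᵐ p ∂(π ⊗ₘ q), ∫⁻ u, ENNReal.ofReal (pmrRatio π q Q φ u p.1 p.2) ∂(Q p) ≤
      ENNReal.ofReal (mhRatio π q p.1 p.2) := by
  have hφQ : IsMarkovKernel (Q.map φ) := Kernel.IsMarkovKernel.map Q hφ
  have hR : Measurable fun z : X × X × U => ENNReal.ofReal (pmrRatio π q Q φ z.2.2 z.1 z.2.1) :=
    measurable_pmrRatio.ennreal_ofReal
  have hm : Measurable fun p : X × X =>
      ∫⁻ u, ENNReal.ofReal (pmrRatio π q Q φ u p.1 p.2) ∂(Q p) :=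
    (hR.comp (by fun_prop : Measurable fun z : (X × X) × U =>
      (z.1.1, z.1.2, z.2))).lintegral_kernel_prod_right'
  refine ae_le_acceptanceRatio hm ?_
  refine Measure.le_iff.2 fun s hs => ?_
  set T : Set (X × X × U) := (fun z : X × X × U => (z.1, z.2.1)) ⁻¹' s with hT
  have hTm : MeasurableSet T := hs.preimage (by fun_prop)
  have e₁ : (π ⊗ₘ q).withDensity
      (fun p => ∫⁻ u, ENNReal.ofReal (pmrRatio π q Q φ u p.1 p.2) ∂(Q p)) s =
      (π ⊗ₘ (q ⊗ₖ Q)).withDensity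
        (fun z => ENNReal.ofReal (pmrRatio π q Q φ z.2.2 z.1 z.2.1)) T := by
    rw [withDensity_apply _ hs, withDensity_apply _ hTm, ← lintegral_indicator hs,
      ← lintegral_indicator hTm, Measure.lintegral_compProd (hm.indicator hs),
      Measure.lintegral_compProd (hR.indicator hTm)]
    refine lintegral_congr fun x => ?_
    refine Eq.trans ?_ (Kernel.lintegral_compProd _ _ _
      ((hR.indicator hTm).comp measurable_prodMk_left)).symm
    refine lintegral_congr fun y => ?_
    by_cases h : (x, y) ∈ s
    · simp [hT, h, Set.indicator]
    · simp [hT, h, Set.indicator]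
  have e₂ : (π ⊗ₘ (q ⊗ₖ (Q.map φ))).map (fun p : X × X × U => (p.2.1, p.1, p.2.2)) T =
      (π ⊗ₘ q).map Prod.swap s := by
    rw [Measure.map_apply (by fun_prop) hTm, Measure.map_apply measurable_swap hs,
      Measure.compProd_apply (measurable_swap hs),
      Measure.compProd_apply (hTm.preimage (by fun_prop))]
    refine lintegral_congr fun x => ?_
    rw [Kernel.compProd_apply ((hTm.preimage (by fun_prop)).preimage measurable_prodMk_left)]
    have : ∀ y, (Q.map φ) (x, y) (Prod.mk y ⁻¹' (Prod.mk x ⁻¹'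
        ((fun p : X × X × U => (p.2.1, p.1, p.2.2)) ⁻¹' T))) =
        (Prod.mk x ⁻¹' (Prod.swap ⁻¹' s)).indicator 1 y := fun y => by
      have : Prod.mk y ⁻¹' (Prod.mk x ⁻¹' ((fun p : X × X × U => (p.2.1, p.1, p.2.2)) ⁻¹' T)) =
          {_u : U | (y, x) ∈ s} := rfl
      rw [this]
      by_cases h : (y, x) ∈ s <;> simp [Set.indicator, h]
    simp only [this]
    rw [lintegral_indicator_one ((measurable_swap hs).preimage measurable_prodMk_left)]
  rw [e₁, ← e₂]
  refine (congrArg (fun m : Measure (X × X × U) => m T) withDensity_acceptanceRatio).trans_le ?_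
  exact Measure.restrict_le_self _

/-- Jensen's inequality for the concave function `min{1, ·}`. -/
theorem ae_meanAccept_le [IsFiniteMeasure π] (hN : 1 ≤ N) (hφ : Measurable φ) :
    ∀ᵐ p ∂(π ⊗ₘ q), meanAccept π q Q φ J p ≤
      ENNReal.ofReal (min 1 (mhRatio π q p.1 p.2)) := by
  filter_upwards [ae_lintegral_pmrRatio_le (π := π) (q := q) (Q := Q) hφ] with p hp
  rw [ENNReal.ofReal_min, ENNReal.ofReal_one, meanAccept]
  have hN' : (N : ℝ≥0∞) ≠ 0 := by exact_mod_cast (by omega : N ≠ 0)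
  refine le_min ?_ (le_trans ?_ hp)
  · calc _ ≤ ∫⁻ _, 1 ∂(J.joint p) :=
          lintegral_mono fun 𝔲 => ENNReal.ofReal_le_one.2 (min_le_left _ _)
      _ = 1 := by simp
  · have hr := measurable_pmrRatio_left (π := π) (q := q) (Q := Q) (φ := φ) p.1 p.2
    calc ∫⁻ 𝔲, ENNReal.ofReal (min 1 (avgRatio π q Q φ 𝔲 p.1 p.2)) ∂(J.joint p)
        ≤ ∫⁻ 𝔲, (N : ℝ≥0∞)⁻¹ * ∑ i, ENNReal.ofReal (pmrRatio π q Q φ (𝔲 i) p.1 p.2)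
            ∂(J.joint p) := by
          refine lintegral_mono fun 𝔲 => (ENNReal.ofReal_le_ofReal (min_le_right _ _)).trans_eq ?_
          rw [avgRatio, div_eq_inv_mul, ENNReal.ofReal_mul (by positivity),
            ENNReal.ofReal_inv_of_pos (by exact_mod_cast hN), ENNReal.ofReal_natCast,
            ENNReal.ofReal_sum_of_nonneg fun i _ => pmrRatio_nonneg _ _ _]
      _ = ∫⁻ u, ENNReal.ofReal (pmrRatio π q Q φ u p.1 p.2) ∂(Q p) := by
          have hi : ∀ i, Measurable fun 𝔲 : Fin N → U =>
              ENNReal.ofReal (pmrRatio π q Q φ (𝔲 i) p.1 p.2) := fun i =>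
            hr.comp (measurable_pi_apply i)
          rw [lintegral_const_mul _ (Finset.measurable_sum _ fun i _ => hi i),
            lintegral_finsetSum _ fun i _ => hi i]
          simp only [J.lintegral_eval _ p hr]
          rw [Finset.sum_const, Finset.card_univ, Fintype.card_fin, nsmul_eq_mul, ← mul_assoc,
            ENNReal.inv_mul_cancel hN' (ENNReal.natCast_ne_top N), one_mul]

/-- The mean acceptance probability increases with the number of averaged ratios: the average
of all the `M` ratios is the mean, over the cyclic shifts of the index set, of averages of `N` of
them, all with the same law by exchangeability; and `min{1, ·}` is concave. -/
theorem meanAccept_mono {M : ℕ} (hNM : N ≤ M) (hN : 1 ≤ N) (K : JointLaw Q M)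
    (hK : K.Exchangeable) (hJK : J.IsInitialPartOf K hNM) (p : X × X) :
    meanAccept π q Q φ J p ≤ meanAccept π q Q φ K p := by
  have : NeZero M := ⟨by omega⟩
  have hM' : (M : ℝ≥0∞) ≠ 0 := by exact_mod_cast NeZero.ne M
  have hNpos : (0 : ℝ) < N := by exact_mod_cast hN
  have hMpos : (0 : ℝ) < M := by exact_mod_cast hN.trans hNM
  have hmeas : ∀ L : ℕ, Measurable fun 𝔲 : Fin L → U =>
      ENNReal.ofReal (min 1 (avgRatio π q Q φ 𝔲 p.1 p.2)) := fun L =>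
    (measurable_const.min (measurable_avgRatio.comp
      (f := fun 𝔲 : Fin L → U => (p.1, p.2, 𝔲)) (by fun_prop))).ennreal_ofReal
  have hshift : ∀ j : Fin M, meanAccept π q Q φ J p = ∫⁻ 𝔲, ENNReal.ofReal (min 1
      (avgRatio π q Q φ (fun i => 𝔲 (Fin.castLE hNM i + j)) p.1 p.2)) ∂(K.joint p) := fun j => by
    have h1 : Measurable fun 𝔲 : Fin M → U => fun i => 𝔲 (Fin.castLE hNM i) := by fun_prop
    have h2 : Measurable fun 𝔲 : Fin M → U => fun i => 𝔲 (Equiv.addRight j i) := by fun_prop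
    rw [meanAccept, ← hJK p, lintegral_map (hmeas N) h1]
    conv_lhs => rw [← hK p (Equiv.addRight j)]
    exact lintegral_map ((hmeas N).comp h1) h2
  have hpt : ∀ 𝔲 : Fin M → U, ∑ j : Fin M, ENNReal.ofReal (min 1
      (avgRatio π q Q φ (fun i => 𝔲 (Fin.castLE hNM i + j)) p.1 p.2)) ≤
      M * ENNReal.ofReal (min 1 (avgRatio π q Q φ 𝔲 p.1 p.2)) := fun 𝔲 => by
    rw [← ENNReal.ofReal_sum_of_nonneg fun j _ => le_min zero_le_one (avgRatio_nonneg _ _ _),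
      ← ENNReal.ofReal_natCast, ← ENNReal.ofReal_mul hMpos.le]
    refine ENNReal.ofReal_le_ofReal ?_
    have hsum : ∑ j : Fin M, avgRatio π q Q φ (fun i => 𝔲 (Fin.castLE hNM i + j)) p.1 p.2 =
        M * avgRatio π q Q φ 𝔲 p.1 p.2 := by
      simp only [avgRatio]
      rw [← Finset.sum_div, Finset.sum_comm]
      have : ∀ i : Fin N, ∑ j : Fin M, pmrRatio π q Q φ (𝔲 (Fin.castLE hNM i + j)) p.1 p.2 =
          ∑ j, pmrRatio π q Q φ (𝔲 j) p.1 p.2 := fun i =>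
        Equiv.sum_comp (Equiv.addLeft (Fin.castLE hNM i))
          (fun j => pmrRatio π q Q φ (𝔲 j) p.1 p.2)
      simp only [this, Finset.sum_const, Finset.card_univ, Fintype.card_fin, nsmul_eq_mul]
      field_simp
    rw [mul_min_of_nonneg _ _ hMpos.le, ← hsum]
    refine le_min ?_ (Finset.sum_le_sum fun j _ => min_le_right _ _)
    calc _ ≤ ∑ _j : Fin M, (1 : ℝ) := Finset.sum_le_sum fun j _ => min_le_left _ _
      _ = M * 1 := by simp
  have hmul : M * meanAccept π q Q φ J p ≤ M * meanAccept π q Q φ K p := by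
    calc M * meanAccept π q Q φ J p = ∑ j : Fin M, ∫⁻ 𝔲, ENNReal.ofReal (min 1
          (avgRatio π q Q φ (fun i => 𝔲 (Fin.castLE hNM i + j)) p.1 p.2)) ∂(K.joint p) := by
          simp only [← hshift]
          simp
      _ = ∫⁻ 𝔲, ∑ j : Fin M, ENNReal.ofReal (min 1
          (avgRatio π q Q φ (fun i => 𝔲 (Fin.castLE hNM i + j)) p.1 p.2)) ∂(K.joint p) :=
          (lintegral_finsetSum _ fun j _ => (hmeas N).comp (by fun_prop)).symm
      _ ≤ ∫⁻ 𝔲, M * ENNReal.ofReal (min 1 (avgRatio π q Q φ 𝔲 p.1 p.2)) ∂(K.joint p) :=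
          lintegral_mono hpt
      _ = M * meanAccept π q Q φ K p := lintegral_const_mul _ (hmeas M)
  exact (ENNReal.mul_le_mul_iff_right hM' (ENNReal.natCast_ne_top M)).1 hmul

/-- Dirichlet forms need to be compared for measurable functions only. -/
theorem dirichletForm_le_of_measurable [IsProbabilityMeasure π] {P₁ P₂ : Kernel X X}
    [IsMarkovKernel P₁] [IsMarkovKernel P₂] (hP₁ : P₁.Invariant π) (hP₂ : P₂.Invariant π)
    (h : ∀ f : X → ℝ, Measurable f → dirichletForm π P₁ f ≤ dirichletForm π P₂ f)
    {f : X → ℝ} (hf : MemLp f 2 π) : dirichletForm π P₁ f ≤ dirichletForm π P₂ f := by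
  have hf' : MemLp (hf.1.mk f) 2 π := (memLp_congr_ae hf.1.ae_eq_mk).1 hf
  have e : hf.toLp f = hf'.toLp (hf.1.mk f) := (MemLp.toLp_eq_toLp_iff hf hf').2 hf.1.ae_eq_mk
  rw [dirichletForm_eq hP₁ hf, dirichletForm_eq hP₂ hf, e, ← dirichletForm_eq hP₁ hf',
    ← dirichletForm_eq hP₂ hf']
  exact h _ hf.1.stronglyMeasurable_mk.measurable

theorem dirichletForm_avgKernel_le_mhKernel [IsProbabilityMeasure π] (hN : 1 ≤ N)
    (hφ : Measurable φ) {f : X → ℝ} (hf : MemLp f 2 π) :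
    dirichletForm π (avgKernel π q Q φ J) f ≤ dirichletForm π (mhKernel π q) f := by
  have := isMarkovKernel_avgKernel (π := π) (q := q) J hN hφ
  have hJ := isReversible_avgKernel (π := π) (q := q) J hN hφ
  have hP := isReversible_mhKernel (π := π) (q := q)
  refine dirichletForm_le_of_measurable hJ.invariant hP.invariant (fun f hf => ?_) hf
  have hm : Measurable fun p : X × X => ENNReal.ofReal (min 1 (mhRatio π q p.1 p.2)) :=
    (measurable_const.min measurable_mhRatio).ennreal_ofReal
  have hg : Measurable fun p : X × X => ENNReal.ofReal ((f p.1 - f p.2) ^ 2) := by fun_prop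
  rw [dirichletForm_avgKernel J hN hφ hf, mhKernel,
    dirichletForm_acceptReject measurable_mhAccept hf, acceptedFlow_mh hg]
  refine mul_le_mul_right ?_ _
  refine le_of_le_of_eq ?_ (Measure.lintegral_compProd (hm.mul hg)).symm
  refine lintegral_mono_ae ?_
  filter_upwards [Measure.ae_ae_of_ae_compProd
    (ae_meanAccept_le (π := π) (q := q) J hN hφ)] with x hx
  refine lintegral_mono_ae ?_
  filter_upwards [hx] with y hy
  exact mul_le_mul_left hy _

theorem dirichletForm_avgKernel_mono [IsProbabilityMeasure π] {M : ℕ} (hNM : N ≤ M) (hN : 1 ≤ N)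
    (hφ : Measurable φ) (K : JointLaw Q M) (hK : K.Exchangeable) (hJK : J.IsInitialPartOf K hNM)
    {f : X → ℝ} (hf : MemLp f 2 π) :
    dirichletForm π (avgKernel π q Q φ J) f ≤ dirichletForm π (avgKernel π q Q φ K) f := by
  have hM := hN.trans hNM
  have := isMarkovKernel_avgKernel (π := π) (q := q) J hN hφ
  have := isMarkovKernel_avgKernel (π := π) (q := q) K hM hφ
  refine dirichletForm_le_of_measurable (isReversible_avgKernel J hN hφ).invariant
    (isReversible_avgKernel K hM hφ).invariant (fun f hf => ?_) hf
  rw [dirichletForm_avgKernel J hN hφ hf, dirichletForm_avgKernel K hM hφ hf]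
  gcongr with x y
  exact meanAccept_mono J hNM hN K hK hJK (x, y)

end AveragedKernel

end MHAAR

theorem theorem2 {X U : Type*} [MeasurableSpace X] [MeasurableSpace U]
    (π : Measure X) [IsProbabilityMeasure π]
    (q : Kernel X X) [IsMarkovKernel q]
    (Q : Kernel (X × X) U) [IsMarkovKernel Q]
    (φ : U → U) (hφ : Measurable φ) (hφ_inv : Function.Involutive φ) :
    -- reversibility
    (∀ N : ℕ, 1 ≤ N → ∀ J : MHAAR.JointLaw Q N,
      Kernel.IsReversible (MHAAR.avgKernel π q Q φ J) π) ∧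
    -- comparison with the Metropolis-Hastings kernel
    (∀ N : ℕ, 1 ≤ N → ∀ J : MHAAR.JointLaw Q N, J.Exchangeable →
      MHAAR.rightGap π (MHAAR.avgKernel π q Q φ J) ≤ MHAAR.rightGap π (MHAAR.mhKernel π q) ∧
      ∀ f : X → ℝ, MemLp f 2 π →
        MHAAR.AsymptoticVarianceExists π (MHAAR.avgKernel π q Q φ J) f ∧
        MHAAR.AsymptoticVarianceExists π (MHAAR.mhKernel π q) f ∧
        MHAAR.asymptoticVariance π (MHAAR.mhKernel π q) f ≤
          MHAAR.asymptoticVariance π (MHAAR.avgKernel π q Q φ J) f) ∧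
    -- monotonicity in the number of averaged ratios
    (∀ (N M : ℕ) (hNM : N ≤ M), 1 ≤ N →
      ∀ (J : MHAAR.JointLaw Q N) (K : MHAAR.JointLaw Q M), J.Exchangeable → K.Exchangeable →
        J.IsInitialPartOf K hNM →
        MHAAR.rightGap π (MHAAR.avgKernel π q Q φ J) ≤
          MHAAR.rightGap π (MHAAR.avgKernel π q Q φ K) ∧
        ∀ f : X → ℝ, MemLp f 2 π →
          MHAAR.dirichletForm π (MHAAR.avgKernel π q Q φ J) f ≤
            MHAAR.dirichletForm π (MHAAR.avgKernel π q Q φ K) f ∧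
          MHAAR.autocovariance π (MHAAR.avgKernel π q Q φ K) f ≤
            MHAAR.autocovariance π (MHAAR.avgKernel π q Q φ J) f ∧
          MHAAR.asymptoticVariance π (MHAAR.avgKernel π q Q φ K) f ≤
            MHAAR.asymptoticVariance π (MHAAR.avgKernel π q Q φ J) f) := by
  refine ⟨fun N hN J => MHAAR.isReversible_avgKernel J hN hφ, fun N hN J _ => ?_,
    fun N M hNM hN J K _ hK hJK => ?_⟩
  · have := MHAAR.isMarkovKernel_avgKernel (π := π) (q := q) J hN hφ
    have hP := MHAAR.isReversible_avgKernel (π := π) (q := q) J hN hφ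
    have hE := fun (f : X → ℝ) (hf : MemLp f 2 π) =>
      MHAAR.dirichletForm_avgKernel_le_mhKernel (q := q) J hN hφ hf
    exact ⟨MHAAR.rightGap_mono hE, fun f hf =>
      ⟨MHAAR.asymptoticVarianceExists_of_isReversible hP hf,
        MHAAR.asymptoticVarianceExists_of_isReversible MHAAR.isReversible_mhKernel hf,
        MHAAR.asymptoticVariance_le_of_dirichletForm_le hP MHAAR.isReversible_mhKernel hE hf⟩⟩
  · have hM := hN.trans hNM
    have := MHAAR.isMarkovKernel_avgKernel (π := π) (q := q) J hN hφ
    have := MHAAR.isMarkovKernel_avgKernel (π := π) (q := q) K hM hφ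
    have hJ := MHAAR.isReversible_avgKernel (π := π) (q := q) J hN hφ
    have hK' := MHAAR.isReversible_avgKernel (π := π) (q := q) K hM hφ
    have hE := fun (f : X → ℝ) (hf : MemLp f 2 π) =>
      MHAAR.dirichletForm_avgKernel_mono (q := q) J hNM hN hφ K hK hJK hf
    exact ⟨MHAAR.rightGap_mono hE, fun f hf => ⟨hE f hf,
      MHAAR.autocovariance_le_of_dirichletForm_le hJ.invariant hK'.invariant hf (hE f hf),
      MHAAR.asymptoticVariance_le_of_dirichletForm_le hJ hK' hE hf⟩⟩
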